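/- **Definitions.** Let $K\subset\mathbb R^3$ be a closed convex set with nonempty interior (not necessarily compact) whose boundary $\Sigma=\partial K$ is a $C^\infty$-smooth surface, and assume that $\Sigma$ is *strongly convex*: at every point of $\Sigma$ both principal curvatures (with the sign for which spheres have positive ones) are positive. Let $u\in\mathbb R^3$ be a unit vector. The *dark* (resp. *bright*) side of $\Sigma$ for $u$ is the set of $p\in\Sigma$ such that no point $p+tu$ with $t>0$ (resp. $t<0$) lies in the interior of $K$. The *horizon* $\omega_u$ is the intersection of the dark and the bright side. Let $\ell>0$ and let $\gamma:[0,\ell]\to\Sigma$ be a unit-speed geodesic of $\Sigma$ (a curve with $|\dot\gamma|=1$ whose acceleration is everywhere normal to $\Sigma$). A *development of $\gamma$ in the direction $u$* is a plane curve $\tilde\gamma_u:[0,\ell]\to\mathbb R^2$ parametrized by arc length such that, for some fixed unit vector $\tilde u\in\mathbb R^2$, $\langle\tilde u,\tilde\gamma_u(t)\rangle=\langle u,\gamma(t)\rangle$ for all $t\in[0,\ell]$, and the projection of $\tilde\gamma_u(t)$ to the line normal to $\tilde u$ is monotonic in $t$. The *total curvature* of a curve is the supremum of the sums of exterior angles of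 the polygonal lines inscribed in it. **Statement.** Assume that $\gamma$ crosses the horizon $\omega_u$ transversely, that is, $\dot\gamma(t)$ is not tangent to $\omega_u$ whenever $\gamma(t)\in\omega_u$. Let $t_0<\dots<t_k$ (with $k\ge 0$) be its meeting moments, that is, all the $t\in[0,\ell]$ with $\gamma(t)\in\omega_u$, and let $\alpha_i=\measuredangle(\dot\gamma(t_i),u)-\frac{\pi}{2}$ be the corresponding meeting angles. Then the total curvature of any development $\tilde\gamma_u$ of $\gamma$ in the direction $u$ is at most $$3\pi+2\,\bigl|\alpha_0-\alpha_1+\dots+(-1)^k\alpha_k\bigr| .$$ -/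

import Mathlib

open scoped ContDiff Topology ENNReal RealInnerProductSpace

namespace ConvexSurface

/-- Euclidean 3-space. -/
abbrev E3 : Type := EuclideanSpace ℝ (Fin 3)

/-- The Euclidean plane. -/
abbrev E2 : Type := EuclideanSpace ℝ (Fin 2)

/-- `v` is tangent to the set `S` at `p`: it is the velocity at time `0` of a curve through `p`
that stays in `S`. -/
def IsTangentVector (S : Set E3) (p v : E3) : Prop :=
  ∃ c : ℝ → E3, c 0 = p ∧ (∀ᶠ s in 𝓝 (0 : ℝ), c s ∈ S) ∧ HasDerivAt c v 0

/-- `S` is a smooth (embedded) surface: locally it is a regular level set of a smooth function. -/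
def IsSmoothSurface (S : Set E3) : Prop :=
  ∀ p ∈ S, ∃ (U : Set E3) (f : E3 → ℝ), IsOpen U ∧ p ∈ U ∧ ContDiffOn ℝ ∞ f U ∧
    (∀ x ∈ U, fderiv ℝ f x ≠ 0) ∧ S ∩ U = {x ∈ U | f x = 0}

/-- `n` is an outer unit normal at `p` to the boundary of the convex set `K`. If the boundary is
smooth, there is exactly one at each boundary point. -/
def IsOuterUnitNormal (K : Set E3) (p n : E3) : Prop :=
  ‖n‖ = 1 ∧ ∀ x ∈ K, ⟪x - p, n⟫ ≤ 0

/-- `κ` is a principal curvature at `p` of the boundary of the convex set `K`: an eigenvalue of the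
differential of the outer unit normal. That is, there is a tangent vector `v ≠ 0` at `p`, the
velocity of a curve `c` in the surface, such that the derivative of the outer unit normal `n` along
`c` is `κ • v`. (With this sign, a sphere of radius `r` has principal curvatures `1 / r`.) -/
def IsPrincipalCurvature (K : Set E3) (p : E3) (κ : ℝ) : Prop :=
  ∃ (v : E3) (c n : ℝ → E3), v ≠ 0 ∧ c 0 = p ∧
    (∀ᶠ s in 𝓝 (0 : ℝ), c s ∈ frontier K ∧ IsOuterUnitNormal K (c s) (n s)) ∧
    HasDerivAt c v 0 ∧ HasDerivAt n (κ • v) 0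

/-- The boundary of `K` is a convex surface which is smooth and strongly convex: `K` is a closed
convex set with nonempty interior, its boundary is a smooth surface, and all the principal
curvatures of the boundary are positive. (`K` need not be compact.) -/
structure BoundsSmoothStronglyConvexSurface (K : Set E3) : Prop where
  isClosed : IsClosed K
  convex : Convex ℝ K
  nonempty_interior : (interior K).Nonempty
  smooth : IsSmoothSurface (frontier K)
  curvature_pos : ∀ p ∈ frontier K, ∀ κ : ℝ, IsPrincipalCurvature K p κ → 0 < κ

/-- The dark side, for the direction `u`, of the boundary of `K`. -/
def darkSide (K : Set E3) (u : E3) : Set E3 :=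
  {p | p ∈ frontier K ∧ ∀ t : ℝ, 0 < t → p + t • u ∉ interior K}

/-- The bright side, for the direction `u`, of the boundary of `K`. -/
def brightSide (K : Set E3) (u : E3) : Set E3 :=
  {p | p ∈ frontier K ∧ ∀ t : ℝ, t < 0 → p + t • u ∉ interior K}

/-- The horizon of the direction `u` on the boundary of `K`. -/
def horizon (K : Set E3) (u : E3) : Set E3 :=
  darkSide K u ∩ brightSide K u

/-- The velocity of a curve parametrized by `[0, ℓ]` (one-sided at the ends). -/
noncomputable def velocity (ℓ : ℝ) (γ : ℝ → E3) (t : ℝ) : E3 :=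
  derivWithin γ (Set.Icc 0 ℓ) t

/-- The acceleration of a curve parametrized by `[0, ℓ]` (one-sided at the ends). -/
noncomputable def acceleration (ℓ : ℝ) (γ : ℝ → E3) (t : ℝ) : E3 :=
  derivWithin (velocity ℓ γ) (Set.Icc 0 ℓ) t

/-- `γ`, restricted to `[0, ℓ]`, is a unit-speed geodesic of the surface `S`: its acceleration is
everywhere orthogonal to the surface. -/
structure IsUnitSpeedGeodesic (S : Set E3) (ℓ : ℝ) (γ : ℝ → E3) : Prop where
  contDiffOn : ContDiffOn ℝ 2 γ (Set.Icc 0 ℓ)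
  mem : ∀ t ∈ Set.Icc 0 ℓ, γ t ∈ S
  unit_speed : ∀ t ∈ Set.Icc 0 ℓ, ‖velocity ℓ γ t‖ = 1
  normal_acceleration : ∀ t ∈ Set.Icc 0 ℓ, ∀ v : E3, IsTangentVector S (γ t) v →
    ⟪acceleration ℓ γ t, v⟫ = 0

/-- At each moment of `[0, ℓ]` at which `γ` meets the horizon of `u`, it is not tangent to it. -/
def CrossesHorizonTransversely (K : Set E3) (u : E3) (ℓ : ℝ) (γ : ℝ → E3) : Prop :=
  ∀ t ∈ Set.Icc 0 ℓ, γ t ∈ horizon K u →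
    ¬ IsTangentVector (horizon K u) (γ t) (velocity ℓ γ t)

/-- The meeting angle of `γ` with the horizon of `u` at the meeting moment `t`. -/
noncomputable def meetingAngle (u : E3) (ℓ : ℝ) (γ : ℝ → E3) (t : ℝ) : ℝ :=
  InnerProductGeometry.angle (velocity ℓ γ t) u - Real.pi / 2

/-- The plane curve `δ`, restricted to `[0, ℓ]`, is a development of `γ` in the direction `u`, where
`e` is the unit vector of the plane that plays the role of `u`. -/
structure IsDevelopment (u : E3) (ℓ : ℝ) (γ : ℝ → E3) (e : E2) (δ : ℝ → E2) : Prop where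
  norm_eq_one : ‖e‖ = 1
  arc_length : HasUnitSpeedOn δ (Set.Icc 0 ℓ)
  height : ∀ t ∈ Set.Icc 0 ℓ, ⟪e, δ t⟫ = ⟪u, γ t⟫
  monotone_projection : ∀ w : E2, ⟪w, e⟫ = 0 →
    MonotoneOn (fun t => ⟪w, δ t⟫) (Set.Icc 0 ℓ) ∨ AntitoneOn (fun t => ⟪w, δ t⟫) (Set.Icc 0 ℓ)

/-- The total curvature of a plane curve `δ` restricted to `[a, b]`: the supremum of the sums of
exterior angles of the polygonal lines inscribed in it. The vertices of such a polygonal line are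
`δ (τ 0), …, δ (τ (n + 1))` with `τ 0 < … < τ (n + 1)` in `[a, b]`, its edges are nondegenerate, and
its `n` exterior angles are the angles between consecutive edges. -/
noncomputable def totalCurvature (δ : ℝ → E2) (a b : ℝ) : ℝ≥0∞ :=
  ⨆ (n : ℕ) (τ : ℕ → ℝ) (_ : StrictMonoOn τ (Set.Iic (n + 1)))
    (_ : ∀ i ≤ n + 1, τ i ∈ Set.Icc a b) (_ : ∀ i ≤ n, δ (τ i) ≠ δ (τ (i + 1))),
    ENNReal.ofReal (∑ i ∈ Finset.range n,
      InnerProductGeometry.angle (δ (τ (i + 1)) - δ (τ i)) (δ (τ (i + 2)) - δ (τ (i + 1))))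

end ConvexSurface

namespace ConvexSurface

open Set Filter

/-! The slope of the development is the slope `H = ⟪u, γ'⟫` of the geodesic. In a frame `e, w` with
`w` oriented so that the projection increases, the tangent of `δ` is `H • e + √(1 - H²) • w`, so its
angle is `arcsin H`. Every chord is parallel to a tangent in between
(`exists_chord_eq_smul_tangent`), so the total curvature is at most the variation of `arcsin H`
(`totalCurvature_le_eVariationOn`).

By convexity the acceleration is `a • ν` with `ν` the outer normal and `a ≤ 0`, hence `H' = a * ⟪ν,
u⟫`. The zeros of `⟪ν, u⟫` are the meeting moments, so `H` is monotone between them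
(`monotoneOn_arcsin_slope`). Strong convexity and transversality make the interior zeros simple
(`exists_hasDerivAt_inner_normal_ne_zero`), so the direction of monotonicity alternates
(`exists_alternating_signs`).

The variation is therefore an alternating sum of increments, in which each meeting moment counts
twice and each end of `[0, ℓ]` once. At a meeting moment `arcsin H` is minus the meeting angle; the
two ends contribute at most `π / 2` each. This yields `π` in place of `3 * π`. -/

/-! ### Orthonormal frames of the plane -/

/-- `e, w` is an orthonormal frame of the plane. -/
structure IsPlaneFrame (e w : E2) : Prop where
  norm_left : ‖e‖ = 1
  norm_right : ‖w‖ = 1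
  inner_eq_zero : ⟪w, e⟫ = 0
  expand : ∀ x : E2, x = ⟪e, x⟫ • e + ⟪w, x⟫ • w

lemma IsPlaneFrame.neg_right {e w : E2} (h : IsPlaneFrame e w) : IsPlaneFrame e (-w) where
  norm_left := h.norm_left
  norm_right := by rw [norm_neg, h.norm_right]
  inner_eq_zero := by rw [inner_neg_left, h.inner_eq_zero, neg_zero]
  expand x := by
    rw [inner_neg_left, neg_smul, smul_neg, neg_neg]
    exact h.expand x

lemma exists_isPlaneFrame {e : E2} (he : ‖e‖ = 1) : ∃ w : E2, IsPlaneFrame e w := by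
  have h1 : e 0 ^ 2 + e 1 ^ 2 = 1 := by
    have := EuclideanSpace.real_norm_sq_eq e
    rw [he, Fin.sum_univ_two] at this
    linarith
  refine ⟨!₂[-e 1, e 0], he, ?_, ?_, fun x => ?_⟩
  · rw [EuclideanSpace.norm_eq, Real.sqrt_eq_one, Fin.sum_univ_two]
    simp
    linarith
  · simp [PiLp.inner_apply, Fin.sum_univ_two]
    ring
  · ext i
    fin_cases i
    · simp [PiLp.inner_apply, Fin.sum_univ_two]
      linear_combination -(x 0) * h1
    · simp [PiLp.inner_apply, Fin.sum_univ_two]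
      linear_combination -(x 1) * h1

lemma IsPlaneFrame.inner_eq {e w : E2} (h : IsPlaneFrame e w) (x y : E2) :
    ⟪x, y⟫ = ⟪e, x⟫ * ⟪e, y⟫ + ⟪w, x⟫ * ⟪w, y⟫ := by
  conv_lhs => rw [h.expand y]
  rw [inner_add_right, inner_smul_right, inner_smul_right, real_inner_comm x e,
    real_inner_comm x w]
  ring

lemma IsPlaneFrame.norm_sq_eq {e w : E2} (h : IsPlaneFrame e w) (x : E2) :
    ‖x‖ ^ 2 = ⟪e, x⟫ ^ 2 + ⟪w, x⟫ ^ 2 := by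
  rw [← real_inner_self_eq_norm_sq, h.inner_eq]
  ring

/-! ### Differentiability of the projection of a unit-speed curve -/

lemma eVariationOn_le_of_edist_le {α E F : Type*} [LinearOrder α] [PseudoEMetricSpace E]
    [PseudoEMetricSpace F] {f : α → E} {g : α → F} {s : Set α}
    (h : ∀ x ∈ s, ∀ y ∈ s, x ≤ y → edist (f y) (f x) ≤ edist (g y) (g x)) :
    eVariationOn f s ≤ eVariationOn g s := by
  refine iSup_mono fun p => Finset.sum_le_sum fun i _ => ?_
  exact h _ (p.2.2.2 i) _ (p.2.2.2 (i + 1)) (p.2.2.1 (Nat.le_succ i))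

lemma norm_sub_le_of_hasUnitSpeedOn {E : Type*} [SeminormedAddCommGroup E] {δ : ℝ → E} {s : Set ℝ}
    (hδ : HasUnitSpeedOn δ s) {x y : ℝ} (hx : x ∈ s) (hy : y ∈ s) (hxy : x ≤ y) :
    ‖δ y - δ x‖ ≤ y - x := by
  have h1 := eVariationOn.edist_le δ (s := s ∩ Icc x y) ⟨hy, hxy, le_rfl⟩ ⟨hx, le_rfl, hxy⟩
  rw [hδ hx hy, edist_dist, dist_eq_norm] at h1
  have h2 := (ENNReal.ofReal_le_ofReal_iff (by simpa using hxy)).1 h1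
  simpa using h2

/-- If the height of a unit speed curve has almost constant slope `c`, then the increments of its
monotone projection are almost `√(1 - c²)` times the increments of the parameter. -/
lemma projection_increment_bounds {e w : E2} (hfr : IsPlaneFrame e w) {δ : ℝ → E2} {a b c ε : ℝ}
    (hab : a < b) (hδ : HasUnitSpeedOn δ (Icc a b))
    (hmono : MonotoneOn (fun t => ⟪w, δ t⟫) (Icc a b)) (hc : |c| ≤ 1) (hε : 0 ≤ ε)
    (hh : ∀ x ∈ Icc a b, ∀ y ∈ Icc a b, x ≤ y →
      |⟪e, δ y⟫ - ⟪e, δ x⟫ - c * (y - x)| ≤ ε * (y - x)) :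
    ⟪w, δ b⟫ - ⟪w, δ a⟫ ≤ √(1 - c ^ 2 + 2 * ε) * (b - a) ∧
    (1 - c ^ 2 - 2 * ε) * (b - a) ≤ √(1 - c ^ 2 + 2 * ε) * (⟪w, δ b⟫ - ⟪w, δ a⟫) := by
  have hc2 : c ^ 2 ≤ 1 := by rw [← sq_abs]; nlinarith [abs_nonneg c]
  obtain ⟨hc1, hc1'⟩ := abs_le.1 hc
  set M := √(1 - c ^ 2 + 2 * ε) with hM
  have hM0 : 0 ≤ M := Real.sqrt_nonneg _
  have hMsq : M ^ 2 = 1 - c ^ 2 + 2 * ε := Real.sq_sqrt (by linarith)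
  -- The last bound comes from `r * D ≤ (r² + D²) / 2`, `r² = p² + q²` and `q² ≤ M * D * q`. It is
  -- linear in the increments, so it survives summation over subdivisions.
  have key : ∀ x ∈ Icc a b, ∀ y ∈ Icc a b, x ≤ y →
      0 ≤ ⟪w, δ y⟫ - ⟪w, δ x⟫ ∧ ⟪w, δ y⟫ - ⟪w, δ x⟫ ≤ M * (y - x) ∧
      ‖δ y - δ x‖ ≤ (1 + c ^ 2 + 2 * ε) / 2 * (y - x) + M / 2 * (⟪w, δ y⟫ - ⟪w, δ x⟫) := by
    intro x hx y hy hxy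
    have h0 : 0 ≤ y - x := sub_nonneg.2 hxy
    have hr := norm_sub_le_of_hasUnitSpeedOn hδ hx hy hxy
    have hsq := hfr.norm_sq_eq (δ y - δ x)
    rw [inner_sub_right, inner_sub_right] at hsq
    have hp := hh x hx y hy hxy
    have hq : 0 ≤ ⟪w, δ y⟫ - ⟪w, δ x⟫ := sub_nonneg.2 (hmono hx hy hxy)
    have hr0 := norm_nonneg (δ y - δ x)
    generalize ⟪w, δ y⟫ - ⟪w, δ x⟫ = q at *
    generalize ⟪e, δ y⟫ - ⟪e, δ x⟫ = p at *
    generalize ‖δ y - δ x‖ = r at *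
    generalize y - x = D at *
    have hp1 : |p| ≤ D := abs_le_of_sq_le_sq (by nlinarith) h0
    obtain ⟨hp2, hp3⟩ := abs_le.1 hp1
    have hpc : |p + c * D| ≤ 2 * D := by
      rw [abs_le]; constructor <;> nlinarith
    have hpp : |p ^ 2 - c ^ 2 * D ^ 2| ≤ 2 * ε * D ^ 2 := by
      have : p ^ 2 - c ^ 2 * D ^ 2 = (p - c * D) * (p + c * D) := by ring
      rw [this, abs_mul]
      calc |p - c * D| * |p + c * D| ≤ (ε * D) * (2 * D) := by gcongr
        _ = 2 * ε * D ^ 2 := by ring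
    obtain ⟨hpp1, hpp2⟩ := abs_le.1 hpp
    have hr2 : r ^ 2 ≤ D ^ 2 := by nlinarith
    have hqM : q ≤ M * D := by
      refine abs_le_of_sq_le_sq' ?_ (by positivity) |>.2
      rw [mul_pow, hMsq]
      nlinarith
    refine ⟨hq, hqM, ?_⟩
    rcases h0.eq_or_lt with h0 | h0
    · rw [← h0] at hqM hr ⊢
      have : q = 0 := le_antisymm (by simpa using hqM) hq
      rw [this]; simpa using hr
    · have : r * D ≤ ((1 + c ^ 2 + 2 * ε) / 2 * D + M / 2 * q) * D := by
        nlinarith [sq_nonneg (r - D), mul_nonneg hq (sub_nonneg.2 hqM)]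
      exact le_of_mul_le_mul_right this h0
  have ha : a ∈ Icc a b := left_mem_Icc.2 hab.le
  have hb : b ∈ Icc a b := right_mem_Icc.2 hab.le
  refine ⟨(key a ha b hb hab.le).2.1, ?_⟩
  -- The increments of `g` are the right-hand sides of the chord bounds; comparing the length `b -
  -- a` with the variation of the monotone `g` gives the lower estimate.
  set g : ℝ → ℝ := fun t => (1 + c ^ 2 + 2 * ε) / 2 * t + M / 2 * ⟪w, δ t⟫ with hg
  have hgm : MonotoneOn g (Icc a b) := by
    intro x hx y hy hxy
    have h1 := hmono hx hy hxy
    simp only [hg]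
    gcongr
  have h1 : eVariationOn δ (Icc a b) ≤ eVariationOn g (Icc a b) := by
    refine eVariationOn_le_of_edist_le fun x hx y hy hxy => ?_
    rw [edist_dist, edist_dist, dist_eq_norm, Real.dist_eq]
    refine ENNReal.ofReal_le_ofReal (((key x hx y hy hxy).2.2).trans (le_trans (le_of_eq ?_)
      (le_abs_self _)))
    simp only [hg]; ring
  have h2 := (hgm.eVariationOn_eq ha hb).le
  rw [inter_self] at h2
  have h3 := hδ ha hb
  rw [inter_self] at h3
  rw [h3] at h1
  have h4 := (ENNReal.ofReal_le_ofReal_iff (sub_nonneg.2 (hgm ha hb hab.le))).1 (h1.trans h2)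
  simp only [hg, NNReal.coe_one] at h4
  linarith

/-- Unit speed is a statement about lengths only, so this derivative is not given. Near `s` the
height has slope within `ε` of `H s`, and the increment bounds squeeze the difference quotient as `ε
→ 0`. -/
lemma hasDerivWithinAt_projection {e w : E2} (hfr : IsPlaneFrame e w) {ℓ : ℝ} {δ : ℝ → E2}
    {H : ℝ → ℝ} (hδ : HasUnitSpeedOn δ (Icc 0 ℓ))
    (hmono : MonotoneOn (fun t => ⟪w, δ t⟫) (Icc 0 ℓ))
    (hH : ∀ t ∈ Icc 0 ℓ, HasDerivWithinAt (fun t => ⟪e, δ t⟫) (H t) (Icc 0 ℓ) t)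
    (hHc : ContinuousOn H (Icc 0 ℓ)) (hH1 : ∀ t ∈ Icc 0 ℓ, |H t| ≤ 1) {s : ℝ} (hs : s ∈ Icc 0 ℓ) :
    HasDerivWithinAt (fun t => ⟪w, δ t⟫) (√(1 - H s ^ 2)) (Icc 0 ℓ) s := by
  set c := H s with hcdef
  set B := √(1 - c ^ 2) with hB
  have hc2 : c ^ 2 ≤ 1 := by rw [← sq_abs]; nlinarith [abs_nonneg c, hH1 s hs]
  have hBsq : B ^ 2 = 1 - c ^ 2 := Real.sq_sqrt (by linarith)
  have hB0 : 0 ≤ B := Real.sqrt_nonneg _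
  have hsub : ∀ a b, a ∈ Icc 0 ℓ → b ∈ Icc 0 ℓ → a < b → ∀ ε, 0 ≤ ε →
      (∀ x ∈ Icc a b, |H x - c| ≤ ε) →
      ⟪w, δ b⟫ - ⟪w, δ a⟫ ≤ √(1 - c ^ 2 + 2 * ε) * (b - a) ∧
      (1 - c ^ 2 - 2 * ε) * (b - a) ≤ √(1 - c ^ 2 + 2 * ε) * (⟪w, δ b⟫ - ⟪w, δ a⟫) := by
    intro a b ha hb hab ε hε hx
    have hss : Icc a b ⊆ Icc 0 ℓ := Icc_subset_Icc ha.1 hb.2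
    refine projection_increment_bounds hfr hab ?_ (hmono.mono hss) (hH1 s hs) hε ?_
    · intro x hx y hy
      have := hδ (hss hx) (hss hy)
      rw [← this]
      congr 1
      rw [inter_eq_right.2 (Icc_subset_Icc hx.1 hy.2),
        inter_eq_right.2 (Icc_subset_Icc (hss hx).1 (hss hy).2)]
    · intro x hx' y hy' hxy
      have := Convex.norm_image_sub_le_of_norm_hasDerivWithin_le (s := Icc a b)
        (f := fun t => ⟪e, δ t⟫ - c * t) (f' := fun t => H t - c) (C := ε)
        (fun t ht => (((hH t (hss ht)).mono hss).sub
          ((hasDerivWithinAt_id t _).const_mul c)).congr_deriv (by simp))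
        (fun t ht => hx t ht) (convex_Icc a b) hx' hy'
      simp only [Real.norm_eq_abs, abs_of_nonneg (sub_nonneg.2 hxy)] at this
      convert this using 2
      ring
  rw [hasDerivWithinAt_iff_tendsto_slope, Metric.tendsto_nhdsWithin_nhds]
  intro η hη
  -- For `B = 0` the lower increment bound says nothing in the limit; monotonicity of the projection
  -- replaces it.
  obtain ⟨ε, hε, hε1, hε2⟩ : ∃ ε > 0, √(1 - c ^ 2 + 2 * ε) < B + η ∧
      (B = 0 ∨ (B - η) * √(1 - c ^ 2 + 2 * ε) < 1 - c ^ 2 - 2 * ε) := by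
    have t1 : Tendsto (fun ε : ℝ => √(1 - c ^ 2 + 2 * ε)) (𝓝[>] 0) (𝓝 B) := by
      have : ContinuousAt (fun ε : ℝ => √(1 - c ^ 2 + 2 * ε)) 0 := by fun_prop
      simpa [ContinuousAt] using this.tendsto.mono_left nhdsWithin_le_nhds
    have t2 : Tendsto (fun ε : ℝ => 1 - c ^ 2 - 2 * ε) (𝓝[>] 0) (𝓝 (B ^ 2)) := by
      have : ContinuousAt (fun ε : ℝ => 1 - c ^ 2 - 2 * ε) 0 := by fun_prop
      simpa [ContinuousAt, hBsq] using this.tendsto.mono_left nhdsWithin_le_nhds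
    have e1 := t1.eventually_lt_const (show B < B + η by linarith)
    have e2 : ∀ᶠ ε : ℝ in 𝓝[>] 0, (B = 0 ∨ (B - η) * √(1 - c ^ 2 + 2 * ε) < 1 - c ^ 2 - 2 * ε) := by
      rcases hB0.eq_or_lt with h | h
      · exact Eventually.of_forall fun _ => Or.inl h.symm
      · exact ((t1.const_mul (B - η)).eventually_lt t2 (by nlinarith)).mono fun _ => Or.inr
    obtain ⟨ε, ⟨h1, h2⟩, h3⟩ := ((e1.and e2).and self_mem_nhdsWithin).exists
    exact ⟨ε, h3, h1, h2⟩
  obtain ⟨r, hr, hrH⟩ := Metric.continuousWithinAt_iff.1 (hHc s hs) ε hε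
  refine ⟨r, hr, ?_⟩
  have fin : ∀ D Q : ℝ, 0 < D → 0 ≤ Q → Q ≤ √(1 - c ^ 2 + 2 * ε) * D →
      (1 - c ^ 2 - 2 * ε) * D ≤ √(1 - c ^ 2 + 2 * ε) * Q → |Q / D - B| < η := by
    intro D Q hD hQ h1 h2
    have hM : 0 < √(1 - c ^ 2 + 2 * ε) := Real.sqrt_pos.2 (by linarith)
    rw [abs_lt]
    constructor
    · have : B - η < Q / D := by
        rcases hε2 with h | h
        · have : 0 ≤ Q / D := by positivity
          linarith
        · rw [lt_div_iff₀ hD]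
          have : ((B - η) * D) * √(1 - c ^ 2 + 2 * ε) < Q * √(1 - c ^ 2 + 2 * ε) := by nlinarith
          exact lt_of_mul_lt_mul_right this hM.le
      linarith
    · have : Q / D < B + η := by
        rw [div_lt_iff₀ hD]
        nlinarith
      linarith
  intro x hx hxr
  obtain ⟨hx0, hxs⟩ := hx
  have hxs : x ≠ s := hxs
  rw [Real.dist_eq] at hxr ⊢
  rcases lt_or_gt_of_ne hxs with hlt | hlt
  · obtain ⟨h1, h2⟩ := hsub x s hx0 hs hlt ε hε.le (fun z hz => (hrH (x := z)
      ⟨hx0.1.trans hz.1, hz.2.trans hs.2⟩ (by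
        rw [Real.dist_eq, abs_sub_comm, abs_of_nonneg (sub_nonneg.2 hz.2)]
        rw [abs_sub_comm, abs_of_nonneg (sub_nonneg.2 hlt.le)] at hxr
        linarith [hz.1])).le)
    rw [slope_comm, slope_def_field]
    exact fin _ _ (sub_pos.2 hlt) (sub_nonneg.2 (hmono hx0 hs hlt.le)) h1 h2
  · obtain ⟨h1, h2⟩ := hsub s x hs hx0 hlt ε hε.le (fun z hz => (hrH (x := z)
      ⟨hs.1.trans hz.1, hz.2.trans hx0.2⟩ (by
        rw [Real.dist_eq, abs_of_nonneg (sub_nonneg.2 hz.1)]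
        rw [abs_of_nonneg (sub_nonneg.2 hlt.le)] at hxr
        linarith [hz.2])).le)
    rw [slope_def_field]
    exact fin _ _ (sub_pos.2 hlt) (sub_nonneg.2 (hmono hs hx0 hlt.le)) h1 h2

/-! ### Total curvature and the variation of the tangent angle -/

lemma norm_tangent_eq_one {e w : E2} (hfr : IsPlaneFrame e w) {x : ℝ} (hx : |x| ≤ 1) :
    ‖x • e + √(1 - x ^ 2) • w‖ = 1 := by
  have hx2 : x ^ 2 ≤ 1 := by rw [← sq_abs]; nlinarith [abs_nonneg x]
  have h := hfr.norm_sq_eq (x • e + √(1 - x ^ 2) • w)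
  have hew : ⟪e, w⟫ = 0 := by rw [real_inner_comm, hfr.inner_eq_zero]
  simp only [inner_add_right, inner_smul_right, real_inner_self_eq_norm_sq, hfr.norm_left,
    hfr.norm_right, hfr.inner_eq_zero, hew] at h
  have h2 : √(1 - x ^ 2) ^ 2 = 1 - x ^ 2 := Real.sq_sqrt (by linarith)
  have h3 : ‖x • e + √(1 - x ^ 2) • w‖ ^ 2 = 1 := by rw [h]; linear_combination h2
  exact (pow_eq_one_iff_of_nonneg (norm_nonneg _) two_ne_zero).1 h3

/-- Tangents with nonnegative `w`-component fill a half circle, so slope angles differ by at most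
`π` and `arccos` undoes `cos` on their distance. -/
lemma angle_tangent_eq {e w : E2} (hfr : IsPlaneFrame e w) {x y : ℝ} (hx : |x| ≤ 1)
    (hy : |y| ≤ 1) :
    InnerProductGeometry.angle (x • e + √(1 - x ^ 2) • w) (y • e + √(1 - y ^ 2) • w) =
      |Real.arcsin y - Real.arcsin x| := by
  have hew : ⟪e, w⟫ = 0 := by rw [real_inner_comm, hfr.inner_eq_zero]
  have h : ⟪x • e + √(1 - x ^ 2) • w, y • e + √(1 - y ^ 2) • w⟫ =
      Real.cos (|Real.arcsin y - Real.arcsin x|) := by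
    rw [Real.cos_abs, Real.cos_sub, Real.cos_arcsin, Real.cos_arcsin,
      Real.sin_arcsin (abs_le.1 hx).1 (abs_le.1 hx).2,
      Real.sin_arcsin (abs_le.1 hy).1 (abs_le.1 hy).2]
    simp only [inner_add_right, inner_add_left, inner_smul_right, inner_smul_left,
      real_inner_self_eq_norm_sq, hfr.norm_left, hfr.norm_right, hfr.inner_eq_zero, hew]
    simp
    ring
  rw [InnerProductGeometry.angle, norm_tangent_eq_one hfr hx, norm_tangent_eq_one hfr hy, h]
  simp only [mul_one, div_one]
  refine Real.arccos_cos (abs_nonneg _) (abs_le.2 ?_)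
  constructor <;>
  linarith [Real.arcsin_le_pi_div_two x, Real.arcsin_le_pi_div_two y,
    Real.neg_pi_div_two_le_arcsin x, Real.neg_pi_div_two_le_arcsin y]

/-- A chord of a unit speed curve with monotone projection is parallel to a tangent line between
its ends, with the same orientation. -/
lemma exists_chord_eq_smul_tangent {e w : E2} (hfr : IsPlaneFrame e w) {ℓ : ℝ} {δ : ℝ → E2}
    {H : ℝ → ℝ} (hδ : HasUnitSpeedOn δ (Icc 0 ℓ))
    (hmono : MonotoneOn (fun t => ⟪w, δ t⟫) (Icc 0 ℓ))
    (hH : ∀ t ∈ Icc 0 ℓ, HasDerivWithinAt (fun t => ⟪e, δ t⟫) (H t) (Icc 0 ℓ) t)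
    (hHc : ContinuousOn H (Icc 0 ℓ)) (hH1 : ∀ t ∈ Icc 0 ℓ, |H t| ≤ 1) {a b : ℝ}
    (ha : a ∈ Icc 0 ℓ) (hb : b ∈ Icc 0 ℓ) (hab : a < b) (hne : δ a ≠ δ b) :
    ∃ s ∈ Icc a b, ∃ r : ℝ, 0 < r ∧ δ b - δ a = r • (H s • e + √(1 - H s ^ 2) • w) := by
  have hss : Icc a b ⊆ Icc 0 ℓ := Icc_subset_Icc ha.1 hb.2
  have hnhds : ∀ t ∈ Ioo a b, Icc 0 ℓ ∈ 𝓝 t := fun t ht =>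
    mem_of_superset (Icc_mem_nhds ht.1 ht.2) hss
  have dh : ∀ t ∈ Ioo a b, HasDerivAt (fun t => ⟪e, δ t⟫) (H t) t := fun t ht =>
    (hH t (hss (Ioo_subset_Icc_self ht))).hasDerivAt (hnhds t ht)
  have dy' := fun t ht => hasDerivWithinAt_projection hfr hδ hmono hH hHc hH1 (s := t) ht
  have dy : ∀ t ∈ Ioo a b, HasDerivAt (fun t => ⟪w, δ t⟫) (√(1 - H t ^ 2)) t := fun t ht =>
    (dy' t (hss (Ioo_subset_Icc_self ht))).hasDerivAt (hnhds t ht)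
  have ch : ContinuousOn (fun t => ⟪e, δ t⟫) (Icc a b) := fun t ht =>
    ((hH t (hss ht)).continuousWithinAt).mono hss
  have cy : ContinuousOn (fun t => ⟪w, δ t⟫) (Icc a b) := fun t ht =>
    ((dy' t (hss ht)).continuousWithinAt).mono hss
  have hsq : ∀ s ∈ Ioo a b, √(1 - H s ^ 2) ^ 2 = 1 - H s ^ 2 := fun s hs => by
    refine Real.sq_sqrt ?_
    have := hH1 s (hss (Ioo_subset_Icc_self hs))
    have : H s ^ 2 ≤ 1 := by rw [← sq_abs]; nlinarith [abs_nonneg (H s)]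
    linarith
  have hexp := hfr.expand (δ b - δ a)
  have hne' : δ b - δ a ≠ 0 := sub_ne_zero.2 hne.symm
  have hQ : 0 ≤ ⟪w, δ b⟫ - ⟪w, δ a⟫ := sub_nonneg.2 (hmono ha hb hab.le)
  rw [inner_sub_right, inner_sub_right] at hexp
  -- If `Q = 0`, the projection is constant on the chord and the slope is `±1`. If `Q > 0`, Rolle
  -- for `P * y - Q * h`, with `y` the projection and `h` the height, gives a parallel tangent, and
  -- the sign of `Q` fixes its orientation.
  rcases hQ.eq_or_lt with hQ | hQ
  · obtain ⟨s, hs, hsP⟩ := exists_hasDerivAt_eq_slope _ _ hab ch dh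
    have hconst : ∀ t ∈ Icc a b, ⟪w, δ t⟫ = ⟪w, δ a⟫ := fun t ht => by
      have h1 := hmono ha (hss ht) ht.1
      have h2 := hmono (hss ht) hb ht.2
      simp only at h1 h2
      linarith
    have hB : √(1 - H s ^ 2) = 0 := by
      refine (dy s hs).unique ((hasDerivAt_const s ⟪w, δ a⟫).congr_of_eventuallyEq ?_)
      filter_upwards [Icc_mem_nhds hs.1 hs.2] with t ht using hconst t ht
    have hH2 := hsq s hs
    rw [hB] at hH2
    rw [← hQ, zero_smul, add_zero] at hexp
    have hP : ⟪e, δ b⟫ - ⟪e, δ a⟫ = (b - a) * H s := by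
      rw [hsP]; field_simp [(sub_pos.2 hab).ne']
    have hH2' : H s * H s = 1 := by linarith
    refine ⟨s, Ioo_subset_Icc_self hs, b - a, sub_pos.2 hab, ?_⟩
    rw [hexp, hB, zero_smul, add_zero, smul_smul, hP]
  · set P := ⟪e, δ b⟫ - ⟪e, δ a⟫ with hP
    set Q := ⟪w, δ b⟫ - ⟪w, δ a⟫ with hQdef
    obtain ⟨s, hs, hs0⟩ := exists_hasDerivAt_eq_zero (f := fun t => P * ⟪w, δ t⟫ - Q * ⟪e, δ t⟫)
      (f' := fun t => P * √(1 - H t ^ 2) - Q * H t) hab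
      ((cy.const_mul _).sub (ch.const_mul _) |>.congr fun t _ => rfl) (by simp only [hP, hQdef]; ring)
      (fun t ht => ((dy t ht).const_mul P).sub ((dh t ht).const_mul Q))
    have hB : 0 < √(1 - H s ^ 2) := by
      refine lt_of_le_of_ne (Real.sqrt_nonneg _) fun h => ?_
      have h2 := hsq s hs
      rw [← h] at hs0 h2
      have : H s = 0 := by
        have : Q * H s = 0 := by linarith
        exact (mul_eq_zero.1 this).resolve_left hQ.ne'
      rw [this] at h2
      norm_num at h2
    refine ⟨s, Ioo_subset_Icc_self hs, Q / √(1 - H s ^ 2), div_pos hQ hB, ?_⟩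
    rw [hexp, smul_add, smul_smul, smul_smul, div_mul_cancel₀ _ hB.ne']
    congr 2
    field_simp
    linarith

/-- The total curvature of a unit speed plane curve with monotone projection is at most the
variation of the angle of its tangent. -/
lemma totalCurvature_le_eVariationOn {e w : E2} (hfr : IsPlaneFrame e w) {ℓ : ℝ} {δ : ℝ → E2}
    {H : ℝ → ℝ} (hδ : HasUnitSpeedOn δ (Icc 0 ℓ))
    (hmono : MonotoneOn (fun t => ⟪w, δ t⟫) (Icc 0 ℓ))
    (hH : ∀ t ∈ Icc 0 ℓ, HasDerivWithinAt (fun t => ⟪e, δ t⟫) (H t) (Icc 0 ℓ) t)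
    (hHc : ContinuousOn H (Icc 0 ℓ)) (hH1 : ∀ t ∈ Icc 0 ℓ, |H t| ≤ 1) :
    totalCurvature δ 0 ℓ ≤ eVariationOn (fun t => Real.arcsin (H t)) (Icc 0 ℓ) := by
  refine iSup_le fun n => iSup_le fun τ => iSup_le fun hτ => iSup_le fun hmem => iSup_le fun hne =>
    ?_
  have hex : ∀ i, ∃ s : ℝ, i ≤ n → s ∈ Icc (τ i) (τ (i + 1)) ∧ ∃ r : ℝ, 0 < r ∧
      δ (τ (i + 1)) - δ (τ i) = r • (H s • e + √(1 - H s ^ 2) • w) := fun i => by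
    by_cases hi : i ≤ n
    · obtain ⟨s, hs, h⟩ := exists_chord_eq_smul_tangent hfr hδ hmono hH hHc hH1
        (hmem i (by omega)) (hmem (i + 1) (by omega))
        (hτ (by simp; omega) (by simp; omega) (Nat.lt_succ_self i)) (hne i hi)
      exact ⟨s, fun _ => ⟨hs, h⟩⟩
    · exact ⟨0, fun h => absurd h hi⟩
  choose s hs using hex
  have hsm : ∀ i ≤ n, s i ∈ Icc 0 ℓ := fun i hi =>
    ⟨(hmem i (by omega)).1.trans (hs i hi).1.1, (hs i hi).1.2.trans (hmem (i + 1) (by omega)).2⟩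
  -- The chords span consecutive parameter intervals, so their tangency moments are ordered.
  have hmon : MonotoneOn s (Iic n) := by
    intro i hi j hj hij
    rcases hij.eq_or_lt with rfl | hij
    · exact le_rfl
    · exact ((hs i hi).1.2.trans (hτ.monotoneOn (by simp at *; omega) (by simp at *; omega)
        (Nat.succ_le_of_lt hij))).trans (hs j hj).1.1
  refine le_trans ?_ (eVariationOn.sum_le_of_monotoneOn_Iic (f := fun t => Real.arcsin (H t))
    (n := n) (u := s) hmon hsm)
  rw [ENNReal.ofReal_sum_of_nonneg fun _ _ => InnerProductGeometry.angle_nonneg _ _]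
  refine Finset.sum_le_sum fun i hi => ?_
  have hi : i < n := Finset.mem_range.1 hi
  obtain ⟨-, r, hr, h1⟩ := hs i hi.le
  obtain ⟨-, r', hr', h2⟩ := hs (i + 1) hi
  rw [h1, h2, InnerProductGeometry.angle_smul_left_of_pos _ _ hr,
    InnerProductGeometry.angle_smul_right_of_pos _ _ hr',
    angle_tangent_eq hfr (hH1 _ (hsm i hi.le)) (hH1 _ (hsm (i + 1) hi)), edist_dist, Real.dist_eq]

/-! ### Alternating monotonicity and alternating signs -/

lemma eVariationOn_le_alternating_sum {θ : ℝ → ℝ} {T : ℕ → ℝ} (hT : Monotone T) {σ : ℝ}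
    (hσ : |σ| = 1) {n : ℕ}
    (hmono : ∀ i < n, MonotoneOn (fun s => σ * (-1) ^ i * θ s) (Icc (T i) (T (i + 1)))) :
    eVariationOn θ (Icc (T 0) (T n)) ≤
      ENNReal.ofReal (∑ i ∈ Finset.range n, σ * (-1) ^ i * (θ (T (i + 1)) - θ (T i))) := by
  have hle : ∀ i, T i ≤ T (i + 1) := fun i => hT (Nat.le_succ i)
  rw [← eVariationOn.sum' θ hT, ENNReal.ofReal_sum_of_nonneg]
  · refine Finset.sum_le_sum fun i hi => ?_
    have hm := hmono i (Finset.mem_range.1 hi)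
    have h1 := (hm.eVariationOn_eq (left_mem_Icc.2 (hle i)) (right_mem_Icc.2 (hle i))).le
    rw [inter_self] at h1
    refine (eVariationOn_le_of_edist_le fun x hx y hy hxy => ?_).trans
      (h1.trans (ENNReal.ofReal_le_ofReal (by rw [mul_sub])))
    rw [edist_dist, edist_dist, Real.dist_eq, Real.dist_eq, ← mul_sub, abs_mul, abs_mul, hσ]
    simp
  · intro i hi
    have := hmono i (Finset.mem_range.1 hi) (left_mem_Icc.2 (hle i)) (right_mem_Icc.2 (hle i))
      (hle i)
    rw [mul_sub]
    exact sub_nonneg.2 this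

/-- Neighbouring increments carry opposite signs, so interior values double instead of cancelling.
-/
lemma alternating_sum_sub_eq (a : ℕ → ℝ) (σ : ℝ) (k : ℕ) :
    ∑ i ∈ Finset.range (k + 2), σ * (-1) ^ i * (a (i + 1) - a i) =
      -(σ * a 0) + σ * (-1) ^ (k + 1) * a (k + 2) +
        2 * (σ * ∑ i ∈ Finset.range (k + 1), (-1) ^ i * a (i + 1)) := by
  induction k with
  | zero => simp [Finset.sum_range_succ]; ring
  | succ k ih => rw [Finset.sum_range_succ, ih, Finset.sum_range_succ _ (k + 1)]; ring

lemma forall_pos_or_forall_neg_of_ne_zero {G : ℝ → ℝ} {a b : ℝ} (hc : ContinuousOn G (Ioo a b))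
    (hne : ∀ s ∈ Ioo a b, G s ≠ 0) : (∀ s ∈ Ioo a b, 0 < G s) ∨ (∀ s ∈ Ioo a b, G s < 0) := by
  by_contra! h
  obtain ⟨⟨x, hx, hx0⟩, y, hy, hy0⟩ := h
  obtain ⟨z, hz, hz0⟩ := isPreconnected_Ioo.intermediate_value hx hy hc ⟨hx0, hy0⟩
  exact hne z hz hz0

/-- Were `G` negative on both sides, `b` would be a local maximum and `d` would vanish. -/
lemma pos_right_of_neg_left {G : ℝ → ℝ} {a b c d : ℝ} (hab : a < b) (hbc : b < c)
    (hb : G b = 0) (hd : d ≠ 0) (hG : HasDerivAt G d b) (hc : ContinuousOn G (Ioo b c))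
    (hne : ∀ s ∈ Ioo b c, G s ≠ 0) (hneg : ∀ s ∈ Ioo a b, G s < 0) : ∀ s ∈ Ioo b c, 0 < G s := by
  refine (forall_pos_or_forall_neg_of_ne_zero hc hne).resolve_right fun hneg' => ?_
  have hmax : IsLocalMax G b := by
    filter_upwards [Ioo_mem_nhds hab hbc] with x hx
    rw [hb]
    rcases lt_trichotomy x b with h | rfl | h
    · exact (hneg x ⟨hx.1, h⟩).le
    · exact hb.le
    · exact (hneg' x ⟨h, hx.2⟩).le
  exact hd (hmax.hasDerivAt_eq_zero hG)

/-- A continuous function whose zeros are simple changes its sign at each of them. -/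
lemma exists_alternating_signs {G : ℝ → ℝ} {T : ℕ → ℝ} (hT : Monotone T) {n : ℕ}
    (hstrict : ∀ i, 1 ≤ i → i < n → T i < T (i + 1))
    (hc : ∀ i ≤ n, ContinuousOn G (Ioo (T i) (T (i + 1))))
    (hne : ∀ i ≤ n, ∀ s ∈ Ioo (T i) (T (i + 1)), G s ≠ 0)
    (hzero : ∀ i, 1 ≤ i → i ≤ n → G (T i) = 0)
    (hder : ∀ i, 1 ≤ i → i ≤ n → T 0 < T i → T i < T (n + 1) → ∃ d ≠ 0, HasDerivAt G d (T i)) :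
    ∃ σ : ℝ, |σ| = 1 ∧ ∀ i ≤ n, ∀ s ∈ Ioo (T i) (T (i + 1)), σ * (-1) ^ i * G s < 0 := by
  have step : ∀ i < n, T i < T (i + 1) → ∀ ε : ℝ, ε ≠ 0 →
      (∀ s ∈ Ioo (T i) (T (i + 1)), ε * G s < 0) →
      ∀ s ∈ Ioo (T (i + 1)) (T (i + 1 + 1)), -ε * G s < 0 := by
    intro i hi hlt ε hε h s hs
    have h2 : T (i + 1) < T (i + 1 + 1) := hs.1.trans hs.2
    obtain ⟨d, hd, hG⟩ := hder (i + 1) (by omega) hi ((hT (Nat.zero_le i)).trans_lt hlt)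
      (h2.trans_le (hT (by omega)))
    have := pos_right_of_neg_left hlt h2 (G := fun s => ε * G s) (by simp [hzero (i + 1) (by omega) hi])
      (mul_ne_zero hε hd) (hG.const_mul ε) ((hc (i + 1) hi).const_mul _ |>.congr fun _ _ => rfl)
      (fun s hs => mul_ne_zero hε (hne (i + 1) hi s hs)) h s hs
    linarith
  have start : ∀ i ≤ n, ∃ σ : ℝ, |σ| = 1 ∧ ∀ s ∈ Ioo (T i) (T (i + 1)), σ * (-1) ^ i * G s < 0 := by
    intro i hi
    have hi2 : ((-1 : ℝ) ^ i) * (-1) ^ i = 1 := by rw [← mul_pow]; simp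
    rcases forall_pos_or_forall_neg_of_ne_zero (hc i hi) (hne i hi) with h | h
    · refine ⟨-(-1) ^ i, by simp, fun s hs => ?_⟩
      rw [neg_mul, hi2]; linarith [h s hs]
    · refine ⟨(-1) ^ i, by simp, fun s hs => ?_⟩
      rw [hi2]; linarith [h s hs]
  have forward : ∀ m σ, |σ| = 1 → (∀ i, m ≤ i → i < n → T i < T (i + 1)) →
      (∀ s ∈ Ioo (T m) (T (m + 1)), σ * (-1) ^ m * G s < 0) →
      ∀ i, m ≤ i → i ≤ n → ∀ s ∈ Ioo (T i) (T (i + 1)), σ * (-1) ^ i * G s < 0 := by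
    intro m σ hσ hlt h i hmi
    induction i, hmi using Nat.le_induction with
    | base => exact fun _ => h
    | succ i hmi ih =>
      intro hi s hs
      have hε : σ * (-1) ^ i ≠ 0 := mul_ne_zero (by rintro rfl; simp at hσ) (by simp)
      have := step i hi (hlt i hmi hi) _ hε (ih (by omega)) s hs
      rw [pow_succ]
      linarith
  -- If the first zero is the left end, the initial interval is empty and no derivative is available
  -- at `T 1`, so the sign is propagated from the second interval.
  rcases (hT (Nat.zero_le 1)).eq_or_lt with h01 | h01
  · rcases Nat.eq_zero_or_pos n with rfl | hn
    · refine ⟨1, by simp, fun i hi s hs => ?_⟩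
      obtain rfl : i = 0 := by omega
      rw [← h01] at hs
      exact absurd hs (by simp)
    · obtain ⟨σ, hσ, h⟩ := start 1 hn
      refine ⟨σ, hσ, fun i hi => ?_⟩
      rcases Nat.eq_zero_or_pos i with rfl | hi0
      · intro s hs
        rw [zero_add, ← h01] at hs
        exact absurd hs (by simp)
      · exact forward 1 σ hσ hstrict h i hi0 hi
  · obtain ⟨σ, hσ, h⟩ := start 0 (Nat.zero_le n)
    refine ⟨σ, hσ, fun i hi => forward 0 σ hσ (fun j _ hj => ?_) h i (Nat.zero_le i) hi⟩
    rcases Nat.eq_zero_or_pos j with rfl | hj0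
    · exact h01
    · exact hstrict j hj0 hj

/-! ### Tangent vectors, outer normals and the horizon -/

/-- Kernel vectors of a submersion are tangent to its level set. -/
lemma isTangentVector_of_hasStrictFDerivAt {F : Type*} [NormedAddCommGroup F] [NormedSpace ℝ F]
    [FiniteDimensional ℝ F] {f : E3 → F} {f' : E3 →L[ℝ] F} {p v : E3} {S : Set E3}
    (hf : HasStrictFDerivAt f f' p) (hsurj : f'.range = ⊤)
    (hS : ∀ᶠ x in 𝓝 p, f x = f p → x ∈ S) (hv : f' v = 0) : IsTangentVector S p v := by
  set φ := hf.implicitFunction f f' hsurj (f p) with hφ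
  have h0 : φ 0 = p := hf.implicitFunction_apply_image hsurj
  have hd := (hf.to_implicitFunction hsurj).hasFDerivAt
  let w : f'.ker := ⟨v, hv⟩
  have hline : HasDerivAt (fun s : ℝ => s • w) w 0 := by
    simpa using (hasDerivAt_id (0 : ℝ)).smul_const w
  have hline0 : Tendsto (fun s : ℝ => s • w) (𝓝 0) (𝓝 0) := by
    simpa using hline.continuousAt.tendsto
  have hd' : HasFDerivAt φ f'.ker.subtypeL ((0 : ℝ) • w) := by rw [zero_smul]; exact hd
  have hc : HasDerivAt (fun s : ℝ => φ (s • w)) v 0 := by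
    simpa [Function.comp_def] using! hd'.comp_hasDerivAt (0 : ℝ) hline
  have hc0 : φ ((0 : ℝ) • w) = p := by rw [zero_smul, h0]
  refine ⟨fun s => φ (s • w), hc0, ?_, hc⟩
  have e1 : ∀ᶠ s : ℝ in 𝓝 0, f (φ (s • w)) = f p :=
    (tendsto_const_nhds.prodMk_nhds hline0).eventually (hf.map_implicitFunction_eq hsurj)
  have e2 : Tendsto (fun s : ℝ => φ (s • w)) (𝓝 0) (𝓝 p) := by
    have := hc.continuousAt.tendsto
    rwa [hc0] at this
  filter_upwards [e1, e2.eventually hS] with s h1 h2 using h2 h1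

/-- Hahn–Banach separates the interior from the line; a functional bounded below on a line is
constant along it. With `u = 0` this is the supporting plane at a boundary point. -/
lemma exists_isOuterUnitNormal_of_line {K : Set E3} (hconv : Convex ℝ K)
    (hint : (interior K).Nonempty) {p u : E3}
    (hline : ∀ t : ℝ, p + t • u ∉ interior K) : ∃ n, IsOuterUnitNormal K p n ∧ ⟪n, u⟫ = 0 := by
  have hL : Convex ℝ (range fun t : ℝ => p + t • u) := by
    have : range (fun t : ℝ => p + t • u) = (AffineMap.lineMap p (p + u) : ℝ →ᵃ[ℝ] E3) '' univ := by
      rw [image_univ]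
      congr 1
      ext t i
      simp [AffineMap.lineMap_apply]; ring
    rw [this]
    exact convex_univ.affine_image _
  obtain ⟨φ, c, h1, h2⟩ := geometric_hahn_banach_open hconv.interior isOpen_interior hL
    (by rw [Set.disjoint_right]; rintro _ ⟨t, rfl⟩; exact hline t)
  have h2' : ∀ t : ℝ, c ≤ φ p + t * φ u := fun t => by
    simpa using h2 _ ⟨t, rfl⟩
  have hφu : φ u = 0 := by
    by_contra h
    have := h2' ((c - 1 - φ p) / φ u)
    rw [div_mul_cancel₀ _ h] at this
    linarith
  have hcp : c ≤ φ p := by simpa using h2' 0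
  have hK : ∀ x ∈ K, φ x ≤ φ p := by
    intro x hx
    have hx' : x ∈ closure (interior K) := by
      rw [hconv.closure_interior_eq_closure_of_nonempty_interior hint]
      exact subset_closure hx
    have : closure (interior K) ⊆ {x | φ x ≤ c} :=
      closure_minimal (fun y hy => (h1 y hy).le) (isClosed_le φ.continuous continuous_const)
    exact (this hx').trans hcp
  set m : E3 := (InnerProductSpace.toDual ℝ E3).symm φ with hm
  have hmx : ∀ x, ⟪m, x⟫ = φ x := fun x => InnerProductSpace.toDual_symm_apply
  have hm0 : m ≠ 0 := by
    intro h
    obtain ⟨z, hz⟩ := hint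
    have := h1 z hz
    rw [← hmx, h, inner_zero_left] at this
    rw [← hmx, h, inner_zero_left] at hcp
    linarith
  have hm1 : 0 < ‖m‖ := norm_pos_iff.2 hm0
  refine ⟨‖m‖⁻¹ • m, ⟨?_, fun x hx => ?_⟩, ?_⟩
  · rw [norm_smul, norm_inv, norm_norm, inv_mul_cancel₀ hm1.ne']
  · rw [inner_smul_right, real_inner_comm, inner_sub_right, hmx, hmx]
    exact mul_nonpos_of_nonneg_of_nonpos (by positivity) (sub_nonpos.2 (hK x hx))
  · rw [inner_smul_left, hmx, hφu, mul_zero]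

/-- An interior point can be pushed a little along `n` without leaving `K`. -/
lemma IsOuterUnitNormal.inner_neg_of_mem_interior {K : Set E3} {p n z : E3}
    (hn : IsOuterUnitNormal K p n) (hz : z ∈ interior K) : ⟪z - p, n⟫ < 0 := by
  have hc : Tendsto (fun ε : ℝ => z + ε • n) (𝓝 0) (𝓝 z) := by
    have : ContinuousAt (fun ε : ℝ => z + ε • n) 0 := by fun_prop
    simpa [ContinuousAt] using this.tendsto
  have hev := hc.eventually (isOpen_interior.mem_nhds hz)
  obtain ⟨ε, h1, h2⟩ := ((hev.filter_mono nhdsWithin_le_nhds).and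
    (self_mem_nhdsWithin : Ioi (0 : ℝ) ∈ 𝓝[>] 0)).exists
  have h3 := hn.2 _ (interior_subset h1)
  rw [show z + ε • n - p = (z - p) + ε • n by abel, inner_add_left, inner_smul_left,
    real_inner_self_eq_norm_sq, hn.1] at h3
  have : (0 : ℝ) < ε := h2
  simp at h3
  linarith

lemma IsOuterUnitNormal.inner_eq_zero_of_isTangentVector {K : Set E3} (hK : IsClosed K)
    {p n v : E3} (hn : IsOuterUnitNormal K p n) (hv : IsTangentVector (frontier K) p v) :
    ⟪v, n⟫ = 0 := by
  obtain ⟨c, hc0, hc, hcd⟩ := hv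
  have hd : HasDerivAt (fun s => ⟪c s - p, n⟫) ⟪v, n⟫ 0 := by
    simpa using (hcd.sub_const p).inner ℝ (hasDerivAt_const 0 n)
  have hmax : IsLocalMax (fun s => ⟪c s - p, n⟫) 0 := by
    filter_upwards [hc] with s hs
    simp only [hc0, sub_self, inner_zero_left]
    exact hn.2 _ (hK.frontier_subset hs)
  exact hmax.hasDerivAt_eq_zero hd

/-- Being both dark and bright means that the whole line in direction `u` misses the interior. -/
lemma mem_horizon_iff {K : Set E3} (hconv : Convex ℝ K)
    (hint : (interior K).Nonempty) {p u : E3} (hp : p ∈ frontier K) :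
    p ∈ horizon K u ↔ ∃ n, IsOuterUnitNormal K p n ∧ ⟪n, u⟫ = 0 := by
  constructor
  · rintro ⟨⟨-, h1⟩, -, h2⟩
    refine exists_isOuterUnitNormal_of_line hconv hint fun t => ?_
    rcases lt_trichotomy t 0 with ht | rfl | ht
    · exact h2 t ht
    · rw [zero_smul, add_zero]
      exact hp.2
    · exact h1 t ht
  · rintro ⟨n, hn, hnu⟩
    have : ∀ t : ℝ, p + t • u ∉ interior K := fun t ht => by
      have := hn.inner_neg_of_mem_interior ht
      rw [add_sub_cancel_left, inner_smul_left, real_inner_comm, hnu, mul_zero] at this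
      exact lt_irrefl _ this
    exact ⟨⟨hp, fun t _ => this t⟩, hp, fun t _ => this t⟩

lemma eq_smul_of_inner_eq_zero {E : Type*} [NormedAddCommGroup E] [InnerProductSpace ℝ E]
    {w n : E} (hw : w ≠ 0) (h : ∀ v : E, ⟪w, v⟫ = 0 → ⟪v, n⟫ = 0) :
    n = (⟪w, n⟫ / ‖w‖ ^ 2) • w := by
  have hw' : ‖w‖ ^ 2 ≠ 0 := pow_ne_zero 2 (norm_ne_zero_iff.2 hw)
  set v := n - (⟪w, n⟫ / ‖w‖ ^ 2) • w with hv
  have h1 : ⟪w, v⟫ = 0 := by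
    rw [hv, inner_sub_right, inner_smul_right, real_inner_self_eq_norm_sq, div_mul_cancel₀ _ hw',
      sub_self]
  have h2 : ⟪v, v⟫ = 0 := by
    conv_lhs => rw [hv, inner_sub_right, ← hv, inner_smul_right, h v h1, real_inner_comm w v, h1]
    ring
  rw [inner_self_eq_zero] at h2
  exact sub_eq_zero.1 h2

/-! ### Smooth local normal fields and strong convexity -/

/-- On the open set `U`, the frontier of `K` is the zero set of `f`, and `g • ∇ f` is a smooth
extension of the outer unit normal of `K`. -/
structure IsLocalNormalField (K U : Set E3) (f g : E3 → ℝ) : Prop where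
  isOpen : IsOpen U
  contDiffOn_left : ContDiffOn ℝ ∞ f U
  contDiffOn_right : ContDiffOn ℝ ∞ g U
  fderiv_ne_zero : ∀ x ∈ U, fderiv ℝ f x ≠ 0
  frontier_inter : frontier K ∩ U = {x ∈ U | f x = 0}
  norm_eq_one : ∀ x ∈ U, ‖g x • gradient f x‖ = 1
  isOuterUnitNormal : ∀ x ∈ U, x ∈ frontier K → IsOuterUnitNormal K x (g x • gradient f x)
  eq_of_isOuterUnitNormal : ∀ x ∈ U, x ∈ frontier K → ∀ n, IsOuterUnitNormal K x n →
    n = g x • gradient f x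

lemma range_eq_top_of_ne_zero {E : Type*} [NormedAddCommGroup E] [NormedSpace ℝ E]
    {φ : E →L[ℝ] ℝ} (h : φ ≠ 0) : φ.range = ⊤ := by
  refine LinearMap.range_eq_top.2 (LinearMap.surjective_of_ne_zero fun h' => h ?_)
  ext x
  exact LinearMap.congr_fun h' x

lemma isTangentVector_frontier {S U : Set E3} {f : E3 → ℝ} (hU : IsOpen U)
    (hf : ContDiffOn ℝ ∞ f U) (hfd : ∀ x ∈ U, fderiv ℝ f x ≠ 0)
    (hSU : S ∩ U = {x ∈ U | f x = 0}) {p v : E3} (hp : p ∈ S) (hpU : p ∈ U)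
    (hv : fderiv ℝ f p v = 0) : IsTangentVector S p v := by
  have hfp : f p = 0 := by
    have : p ∈ S ∩ U := ⟨hp, hpU⟩
    rw [hSU] at this
    exact this.2
  refine isTangentVector_of_hasStrictFDerivAt
    ((hf.contDiffAt (hU.mem_nhds hpU)).hasStrictFDerivAt (by simp))
    (range_eq_top_of_ne_zero (hfd p hpU)) ?_ hv
  filter_upwards [hU.mem_nhds hpU] with x hx hfx
  have : x ∈ S ∩ U := by
    rw [hSU]
    exact ⟨hx, hfx.trans hfp⟩
  exact this.1

lemma contDiffOn_gradient {U : Set E3} {f : E3 → ℝ} (hU : IsOpen U) (hf : ContDiffOn ℝ ∞ f U) :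
    ContDiffOn ℝ ∞ (gradient f) U :=
  ((InnerProductSpace.toDual ℝ E3).symm.toContinuousLinearEquiv.contDiff.comp_contDiffOn
    (hf.fderiv_of_isOpen hU (by simp)))

lemma gradient_ne_zero {f : E3 → ℝ} {x : E3} (h : fderiv ℝ f x ≠ 0) : gradient f x ≠ 0 := by
  intro h'
  refine h ?_
  ext v
  rw [← inner_gradient_left, h', inner_zero_left]
  rfl

/-- Any outer normal kills the tangent plane, hence is `±∇f / ‖∇f‖`. A fixed interior point `z`
decides the sign: it must lie on the negative side. This is an open condition, so one sign `σ`
serves a whole neighbourhood. -/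
lemma exists_isLocalNormalField {K : Set E3} (hK : BoundsSmoothStronglyConvexSurface K) {p : E3}
    (hp : p ∈ frontier K) : ∃ U f g, p ∈ U ∧ IsLocalNormalField K U f g := by
  obtain ⟨U, f, hU, hpU, hf, hfd, hKU⟩ := hK.smooth p hp
  obtain ⟨z, hz⟩ := hK.nonempty_interior
  have hgrad := contDiffOn_gradient hU hf
  have hex : ∀ x ∈ frontier K, ∃ n, IsOuterUnitNormal K x n := fun x hx => by
    obtain ⟨n, hn, -⟩ := exists_isOuterUnitNormal_of_line (u := 0) hK.convex
      hK.nonempty_interior (fun t => by simpa using hx.2)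
    exact ⟨n, hn⟩
  have hnorm : ∀ x ∈ U, x ∈ frontier K → ∀ n, IsOuterUnitNormal K x n →
      ∃ c : ℝ, n = c • gradient f x ∧ |c| * ‖gradient f x‖ = 1 ∧ c * ⟪z - x, gradient f x⟫ < 0 := by
    intro x hxU hx n hn
    have h1 := eq_smul_of_inner_eq_zero (gradient_ne_zero (hfd x hxU)) (n := n) fun v hv => by
      rw [inner_gradient_left] at hv
      exact hn.inner_eq_zero_of_isTangentVector hK.isClosed
        (isTangentVector_frontier hU hf hfd hKU hx hxU hv)
    refine ⟨_, h1, ?_, ?_⟩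
    · rw [← Real.norm_eq_abs, ← norm_smul, ← h1, hn.1]
    · rw [← inner_smul_right, ← h1]
      exact hn.inner_neg_of_mem_interior hz
  obtain ⟨σ, hσ, hσp⟩ : ∃ σ : ℝ, |σ| = 1 ∧ σ * ⟪z - p, gradient f p⟫ < 0 := by
    obtain ⟨n, hn⟩ := hex p hp
    obtain ⟨c, -, -, hc⟩ := hnorm p hpU hp n hn
    rcases lt_or_gt_of_ne (show ⟪z - p, gradient f p⟫ ≠ 0 by
      intro h; rw [h, mul_zero] at hc; exact lt_irrefl _ hc) with h | h
    · exact ⟨1, by simp, by linarith⟩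
    · exact ⟨-1, by simp, by linarith⟩
  set U' := U ∩ (fun x => σ * ⟪z - x, gradient f x⟫) ⁻¹' Iio 0 with hU'
  have hU'o : IsOpen U' := by
    refine ContinuousOn.isOpen_inter_preimage ?_ hU isOpen_Iio
    have := hgrad.continuousOn
    fun_prop
  have hsub : U' ⊆ U := inter_subset_left
  have huniq : ∀ x ∈ U', x ∈ frontier K → ∀ n, IsOuterUnitNormal K x n →
      n = (σ / ‖gradient f x‖) • gradient f x := by
    intro x hxU hx n hn
    obtain ⟨c, hc, hc1, hc2⟩ := hnorm x (hsub hxU) hx n hn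
    have h2 : σ * ⟪z - x, gradient f x⟫ < 0 := hxU.2
    have hw : 0 < ‖gradient f x‖ := norm_pos_iff.2 (gradient_ne_zero (hfd x (hsub hxU)))
    rw [hc]
    congr 1
    rw [eq_div_iff hw.ne']
    have h3 : (c * ‖gradient f x‖) ^ 2 = 1 := by
      rw [← sq_abs, abs_mul, abs_norm, hc1, one_pow]
    have h4 : σ ^ 2 = 1 := by rw [← sq_abs, hσ, one_pow]
    have h5 : 0 < c * σ := by
      have := mul_pos_of_neg_of_neg hc2 h2
      have h6 : 0 < ⟪z - x, gradient f x⟫ ^ 2 := by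
        refine lt_of_le_of_ne (sq_nonneg _) fun h => ?_
        rw [eq_comm, sq_eq_zero_iff] at h
        rw [h, mul_zero] at h2
        exact lt_irrefl _ h2
      refine pos_of_mul_pos_left (b := ⟪z - x, gradient f x⟫ ^ 2) ?_ h6.le
      linarith
    rcases sq_eq_sq_iff_eq_or_eq_neg.1 (h3.trans h4.symm) with h | h
    · exact h
    · exfalso
      have : c * σ * ‖gradient f x‖ = -1 := by linear_combination σ * h - h4
      have := mul_pos h5 hw
      linarith
  refine ⟨U', f, fun x => σ / ‖gradient f x‖, ⟨hpU, hσp⟩, hU'o, hf.mono hsub, ?_,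
    fun x hx => hfd x (hsub hx), ?_, ?_, ?_, huniq⟩
  · exact contDiffOn_const.div ((hgrad.mono hsub).norm ℝ fun x hx =>
      gradient_ne_zero (hfd x (hsub hx))) fun x hx =>
      (norm_pos_iff.2 (gradient_ne_zero (hfd x (hsub hx)))).ne'
  · ext x
    have := Set.ext_iff.1 hKU x
    constructor
    · rintro ⟨h1, h2⟩
      exact ⟨h2, (this.1 ⟨h1, hsub h2⟩).2⟩
    · rintro ⟨h1, h2⟩
      exact ⟨(this.2 ⟨hsub h1, h2⟩).1, h1⟩
  · intro x hx
    rw [norm_smul, norm_div, norm_norm, Real.norm_eq_abs, hσ, one_div,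
      inv_mul_cancel₀ (norm_pos_iff.2 (gradient_ne_zero (hfd x (hsub hx)))).ne']
  · intro x hxU hx
    obtain ⟨n, hn⟩ := hex x hx
    rw [← huniq x hxU hx n hn]
    exact hn

namespace IsLocalNormalField

variable {K U : Set E3} {f g : E3 → ℝ}

lemma contDiffOn (h : IsLocalNormalField K U f g) :
    ContDiffOn ℝ ∞ (fun x => g x • gradient f x) U :=
  h.contDiffOn_right.smul (contDiffOn_gradient h.isOpen h.contDiffOn_left)

lemma hasStrictFDerivAt (h : IsLocalNormalField K U f g) {p : E3} (hp : p ∈ U) :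
    HasStrictFDerivAt (fun x => g x • gradient f x)
      (fderiv ℝ (fun x => g x • gradient f x) p) p :=
  (h.contDiffOn.contDiffAt (h.isOpen.mem_nhds hp)).hasStrictFDerivAt (by simp)

lemma ne_zero (h : IsLocalNormalField K U f g) {p : E3} (hp : p ∈ U) : g p ≠ 0 := by
  intro h0
  have := h.norm_eq_one p hp
  rw [h0, zero_smul, norm_zero] at this
  exact zero_ne_one this

lemma fderiv_apply_eq_zero_iff (h : IsLocalNormalField K U f g) {p : E3} (hp : p ∈ U) {v : E3} :
    fderiv ℝ f p v = 0 ↔ ⟪g p • gradient f p, v⟫ = 0 := by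
  rw [real_inner_smul_left, inner_gradient_left, mul_eq_zero, or_iff_right (h.ne_zero hp)]

lemma isTangentVector (h : IsLocalNormalField K U f g) {p v : E3} (hp : p ∈ U)
    (hpK : p ∈ frontier K) (hv : ⟪g p • gradient f p, v⟫ = 0) :
    IsTangentVector (frontier K) p v :=
  isTangentVector_frontier h.isOpen h.contDiffOn_left h.fderiv_ne_zero h.frontier_inter hpK hp
    ((h.fderiv_apply_eq_zero_iff hp).2 hv)

/-- The differential of the normal is tangential. -/
lemma inner_fderiv_eq_zero (h : IsLocalNormalField K U f g) {p : E3} (hp : p ∈ U) (v : E3) :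
    ⟪g p • gradient f p, fderiv ℝ (fun x => g x • gradient f x) p v⟫ = 0 := by
  have hd := (h.hasStrictFDerivAt hp).hasFDerivAt
  have h1 := (hd.inner ℝ hd)
  have h2 : HasFDerivAt (fun x => ⟪g x • gradient f x, g x • gradient f x⟫) (0 : E3 →L[ℝ] ℝ) p := by
    refine (hasFDerivAt_const (1 : ℝ) p).congr_of_eventuallyEq ?_
    filter_upwards [h.isOpen.mem_nhds hp] with x hx
    rw [real_inner_self_eq_norm_sq, h.norm_eq_one x hx, one_pow]
  have h3 := congrArg (fun L : E3 →L[ℝ] ℝ => L v) (h1.unique h2)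
  simp only [ContinuousLinearMap.comp_apply, ContinuousLinearMap.prod_apply,
    fderivInnerCLM_apply, zero_apply] at h3
  rw [real_inner_comm (g p • gradient f p)] at h3
  linarith

/-- The differential of the normal is symmetric on tangent vectors. -/
lemma inner_fderiv_comm (h : IsLocalNormalField K U f g) {p v w : E3} (hp : p ∈ U)
    (hv : fderiv ℝ f p v = 0) (hw : fderiv ℝ f p w = 0) :
    ⟪fderiv ℝ (fun x => g x • gradient f x) p v, w⟫ =
      ⟪fderiv ℝ (fun x => g x • gradient f x) p w, v⟫ := by
  have hnhds := h.isOpen.mem_nhds hp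
  have hf := h.contDiffOn_left.contDiffAt hnhds
  have hsymm : IsSymmSndFDerivAt ℝ f p := hf.isSymmSndFDerivAt (by
    rw [minSmoothness_of_isRCLikeNormedField]
    exact WithTop.coe_le_coe.2 (le_top : (2 : ℕ∞) ≤ ⊤))
  have hdg := (h.contDiffOn_right.contDiffAt hnhds).differentiableAt (by simp) |>.hasFDerivAt
  have hddf : HasFDerivAt (fderiv ℝ f) (fderiv ℝ (fderiv ℝ f) p) p :=
    (((h.contDiffOn_left.fderiv_of_isOpen h.isOpen (m := ∞) (by simp)).contDiffAt
      hnhds).differentiableAt (by simp)).hasFDerivAt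
  have hd := (h.hasStrictFDerivAt hp).hasFDerivAt
  -- Differentiating `g • ∇f` also produces a `dg` term, which is multiplied by `fderiv ℝ f p b =
  -- 0`; the symmetric Hessian remains.
  have key : ∀ a b : E3, fderiv ℝ f p b = 0 →
      ⟪fderiv ℝ (fun x => g x • gradient f x) p a, b⟫ = g p * fderiv ℝ (fderiv ℝ f) p a b := by
    intro a b hb
    have h1 := hd.inner ℝ (hasFDerivAt_const b p)
    have h2 : HasFDerivAt (fun x => ⟪g x • gradient f x, b⟫) _ p :=
      (hdg.mul (hddf.clm_apply (hasFDerivAt_const b p))).congr_of_eventuallyEq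
        (Eventually.of_forall fun x => by
          simp only [real_inner_smul_left, inner_gradient_left, Pi.mul_apply])
    have h3 := congrArg (fun L : E3 →L[ℝ] ℝ => L a) (h1.unique h2)
    simpa [hb] using h3
  rw [key v w hw, key w v hv, hsymm v w]

/-- By strong convexity, the differential of the normal has trivial kernel on the tangent plane. -/
lemma fderiv_apply_ne_zero (hK : BoundsSmoothStronglyConvexSurface K)
    (h : IsLocalNormalField K U f g) {p v : E3} (hp : p ∈ U) (hpK : p ∈ frontier K)
    (hv : ⟪g p • gradient f p, v⟫ = 0) (hv0 : v ≠ 0) :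
    fderiv ℝ (fun x => g x • gradient f x) p v ≠ 0 := by
  intro h0
  obtain ⟨c, hc0, hc, hcd⟩ := h.isTangentVector hp hpK hv
  have hcU : ∀ᶠ s in 𝓝 (0 : ℝ), c s ∈ U :=
    hcd.continuousAt.eventually_mem (by rw [hc0]; exact h.isOpen.mem_nhds hp)
  have hpc : IsPrincipalCurvature K p 0 := by
    refine ⟨v, c, fun s => g (c s) • gradient f (c s), hv0, hc0, ?_, hcd, ?_⟩
    · filter_upwards [hc, hcU] with s h1 h2 using ⟨h1, h.isOuterUnitNormal _ h2 h1⟩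
    · rw [zero_smul, ← h0]
      have hd := (h.hasStrictFDerivAt hp).hasFDerivAt
      rw [← hc0] at hd
      have := hd.comp_hasDerivAt (0 : ℝ) hcd
      rw [hc0] at this
      exact this
  exact lt_irrefl _ (hK.curvature_pos p hpK 0 hpc)

/-- Locally the horizon is the zero set of `(f, ⟪u, N⟫)`. This map is a submersion: `w = dN u` is
tangent, and by symmetry `⟪u, dN w⟫ = ‖dN u‖²`, which is nonzero by strong convexity. -/
lemma isTangentVector_horizon (hK : BoundsSmoothStronglyConvexSurface K)
    (h : IsLocalNormalField K U f g) {p u v : E3} (hp : p ∈ U) (hpK : p ∈ frontier K) (hu : u ≠ 0)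
    (hpu : ⟪g p • gradient f p, u⟫ = 0) (hv : ⟪g p • gradient f p, v⟫ = 0)
    (hDv : ⟪fderiv ℝ (fun x => g x • gradient f x) p v, u⟫ = 0) :
    IsTangentVector (horizon K u) p v := by
  set N := fun x => g x • gradient f x with hN
  have hd := h.hasStrictFDerivAt hp
  have hfd : HasStrictFDerivAt f (fderiv ℝ f p) p :=
    (h.contDiffOn_left.contDiffAt (h.isOpen.mem_nhds hp)).hasStrictFDerivAt (by simp)
  have hG : HasStrictFDerivAt (fun x => ⟪u, N x⟫) ((innerSL ℝ u).comp (fderiv ℝ N p)) p :=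
    (innerSL ℝ u).hasStrictFDerivAt.comp p hd
  have hF := hfd.prodMk hG
  have hfp : f p = 0 := by
    have : p ∈ frontier K ∩ U := ⟨hpK, hp⟩
    rw [h.frontier_inter] at this
    exact this.2
  have hDu := h.fderiv_apply_ne_zero hK hp hpK hpu hu
  have hfu : fderiv ℝ f p u = 0 := (h.fderiv_apply_eq_zero_iff hp).2 hpu
  have hfw := (h.fderiv_apply_eq_zero_iff hp).2 (h.inner_fderiv_eq_zero hp u)
  have hsymm := h.inner_fderiv_comm hp hfw hfu
  rw [← hN] at hDu hfw hsymm
  set w := fderiv ℝ N p u with hw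
  have hw0 : ⟪u, fderiv ℝ N p w⟫ ≠ 0 := by
    rw [real_inner_comm, hsymm, real_inner_self_eq_norm_sq]
    exact pow_ne_zero 2 (norm_ne_zero_iff.2 hDu)
  obtain ⟨w', hw'⟩ : ∃ w', fderiv ℝ f p w' ≠ 0 := by
    by_contra! hcon
    exact h.fderiv_ne_zero p hp (by ext x; simpa using hcon x)
  refine isTangentVector_of_hasStrictFDerivAt hF ?_ ?_ ?_
  · refine LinearMap.range_eq_top.2 fun ⟨a, b⟩ => ?_
    -- The system is triangular: `w'` adjusts the first coordinate, then `w` the second without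
    -- disturbing the first.
    refine ⟨(a / fderiv ℝ f p w') • w' + ((b - a / fderiv ℝ f p w' * ⟪u, fderiv ℝ N p w'⟫) /
      ⟪u, fderiv ℝ N p w⟫) • w, ?_⟩
    ext
    · simp [hfw, hw']
    · simp [inner_add_right, inner_smul_right]
      field_simp
      ring
  · filter_upwards [h.isOpen.mem_nhds hp] with x hx hxp
    rw [Prod.mk.injEq] at hxp
    have hxK : x ∈ frontier K := by
      have : x ∈ frontier K ∩ U := by
        rw [h.frontier_inter]
        exact ⟨hx, hxp.1.trans hfp⟩
      exact this.1
    refine (mem_horizon_iff hK.convex hK.nonempty_interior hxK).2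
      ⟨_, h.isOuterUnitNormal x hx hxK, ?_⟩
    rw [real_inner_comm]
    exact hxp.2.trans ((real_inner_comm _ _).trans hpu)
  · ext
    · simpa using (h.fderiv_apply_eq_zero_iff hp).2 hv
    · simpa [real_inner_comm] using hDv

end IsLocalNormalField

/-! ### Velocity and acceleration of geodesics -/

section Geodesic

variable {S : Set E3} {ℓ : ℝ} {γ : ℝ → E3}

lemma IsUnitSpeedGeodesic.hasDerivWithinAt (hγ : IsUnitSpeedGeodesic S ℓ γ) {s : ℝ}
    (hs : s ∈ Icc 0 ℓ) : HasDerivWithinAt γ (velocity ℓ γ s) (Icc 0 ℓ) s :=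
  (hγ.contDiffOn.differentiableOn (by norm_num) s hs).hasDerivWithinAt

lemma IsUnitSpeedGeodesic.contDiffOn_velocity (hγ : IsUnitSpeedGeodesic S ℓ γ) (hℓ : 0 < ℓ) :
    ContDiffOn ℝ 1 (velocity ℓ γ) (Icc 0 ℓ) :=
  hγ.contDiffOn.derivWithin (uniqueDiffOn_Icc hℓ) (by norm_num)

lemma IsUnitSpeedGeodesic.hasDerivAt (hγ : IsUnitSpeedGeodesic S ℓ γ) {s : ℝ}
    (hs : s ∈ Ioo 0 ℓ) : HasDerivAt γ (velocity ℓ γ s) s :=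
  (hγ.hasDerivWithinAt (Ioo_subset_Icc_self hs)).hasDerivAt (Icc_mem_nhds hs.1 hs.2)

lemma IsUnitSpeedGeodesic.hasDerivAt_velocity (hγ : IsUnitSpeedGeodesic S ℓ γ) {s : ℝ}
    (hs : s ∈ Ioo 0 ℓ) : HasDerivAt (velocity ℓ γ) (acceleration ℓ γ s) s :=
  ((hγ.contDiffOn_velocity (hs.1.trans hs.2)).differentiableOn (by norm_num) s
    (Ioo_subset_Icc_self hs)).hasDerivWithinAt.hasDerivAt (Icc_mem_nhds hs.1 hs.2)

lemma IsUnitSpeedGeodesic.isTangentVector_velocity (hγ : IsUnitSpeedGeodesic S ℓ γ) {s : ℝ}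
    (hs : s ∈ Ioo 0 ℓ) : IsTangentVector S (γ s) (velocity ℓ γ s) := by
  refine ⟨fun r => γ (s + r), by simp, ?_, ?_⟩
  · have : Tendsto (fun r => s + r) (𝓝 0) (𝓝 s) := by
      simpa using (continuous_const.add continuous_id).tendsto (0 : ℝ) (f := fun r => s + r)
    filter_upwards [this.eventually (Icc_mem_nhds hs.1 hs.2)] with r hr using hγ.mem _ hr
  · have := hγ.hasDerivAt hs
    rw [← add_zero s] at this
    simpa using this.comp_const_add s 0

/-- A curve on the boundary of a convex set has no outward normal acceleration. -/
lemma IsUnitSpeedGeodesic.inner_acceleration_nonpos {K : Set E3} (hK : IsClosed K)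
    (hγ : IsUnitSpeedGeodesic (frontier K) ℓ γ) {s : ℝ} (hs : s ∈ Ioo 0 ℓ) {n : E3}
    (hn : IsOuterUnitNormal K (γ s) n) : ⟪acceleration ℓ γ s, n⟫ ≤ 0 := by
  by_contra! hpos
  set φ : ℝ → ℝ := fun r => ⟪γ r - γ s, n⟫ with hφ
  have hd : ∀ r ∈ Ioo 0 ℓ, HasDerivAt φ ⟪velocity ℓ γ r, n⟫ r := fun r hr => by
    simpa using ((hγ.hasDerivAt hr).sub_const (γ s)).inner ℝ (hasDerivAt_const r n)
  have hdd : HasDerivAt (deriv φ) ⟪acceleration ℓ γ s, n⟫ s := by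
    have : HasDerivAt (fun r => ⟪velocity ℓ γ r, n⟫) ⟪acceleration ℓ γ s, n⟫ s := by
      simpa using (hγ.hasDerivAt_velocity hs).inner ℝ (hasDerivAt_const s n)
    refine this.congr_of_eventuallyEq ?_
    filter_upwards [Ioo_mem_nhds hs.1 hs.2] with r hr using (hd r hr).deriv
  have hle : ∀ᶠ r in 𝓝 s, φ r ≤ 0 := by
    filter_upwards [Icc_mem_nhds hs.1 hs.2] with r hr
    exact hn.2 _ (hK.frontier_subset (hγ.mem r hr))
  have hφs : φ s = 0 := by simp [hφ]
  have hmax : IsLocalMax φ s := hle.mono fun r hr => hr.trans hφs.ge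
  -- A positive second derivative would make the local maximum also a local minimum, so `φ` would
  -- vanish near `s`, contradicting that derivative.
  have hmin : IsLocalMin φ s := isLocalMin_of_deriv_deriv_pos (by rwa [hdd.deriv])
    hmax.deriv_eq_zero (hd s hs).continuousAt
  have hzero : φ =ᶠ[𝓝 s] fun _ => 0 := by
    filter_upwards [hle, hmin] with r h1 h2
    exact le_antisymm h1 (hφs ▸ h2)
  have h2 : HasDerivAt (deriv φ) 0 s := by
    refine (hasDerivAt_const s (0 : ℝ)).congr_of_eventuallyEq ?_
    filter_upwards [hzero.deriv] with r hr
    rw [hr, deriv_const]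
  exact hpos.ne' (hdd.unique h2)

end Geodesic

/-! ### The normal along the geodesic -/

section Normal

variable {K : Set E3} {ℓ : ℝ} {γ ν : ℝ → E3} {u : E3}

lemma BoundsSmoothStronglyConvexSurface.exists_isOuterUnitNormal
    (hK : BoundsSmoothStronglyConvexSurface K) {p : E3} (hp : p ∈ frontier K) :
    ∃ n, IsOuterUnitNormal K p n := by
  obtain ⟨U, f, g, hpU, h⟩ := exists_isLocalNormalField hK hp
  exact ⟨_, h.isOuterUnitNormal p hpU hp⟩

lemma BoundsSmoothStronglyConvexSurface.isOuterUnitNormal_unique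
    (hK : BoundsSmoothStronglyConvexSurface K) {p n n' : E3} (hp : p ∈ frontier K)
    (hn : IsOuterUnitNormal K p n) (hn' : IsOuterUnitNormal K p n') : n = n' := by
  obtain ⟨U, f, g, hpU, h⟩ := exists_isLocalNormalField hK hp
  rw [h.eq_of_isOuterUnitNormal p hpU hp n hn, h.eq_of_isOuterUnitNormal p hpU hp n' hn']

lemma mem_horizon_iff_inner_eq_zero (hK : BoundsSmoothStronglyConvexSurface K) {p n : E3}
    (hp : p ∈ frontier K) (hn : IsOuterUnitNormal K p n) : p ∈ horizon K u ↔ ⟪n, u⟫ = 0 := by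
  rw [mem_horizon_iff hK.convex hK.nonempty_interior hp]
  exact ⟨fun ⟨n', hn', h⟩ => hK.isOuterUnitNormal_unique hp hn' hn ▸ h, fun h => ⟨n, hn, h⟩⟩

/-- `ν` is only a pointwise choice; uniqueness of the normal transfers to it the regularity of the
local field. -/
lemma IsLocalNormalField.eventually_inner_eq {U : Set E3} {f g : E3 → ℝ}
    (h : IsLocalNormalField K U f g) (hγ : IsUnitSpeedGeodesic (frontier K) ℓ γ)
    (hν : ∀ s ∈ Icc 0 ℓ, IsOuterUnitNormal K (γ s) (ν s)) {s : ℝ} (hs : s ∈ Icc 0 ℓ)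
    (hsU : γ s ∈ U) :
    (fun r => ⟪ν r, u⟫) =ᶠ[𝓝[Icc 0 ℓ] s] fun r => ⟪g (γ r) • gradient f (γ r), u⟫ := by
  filter_upwards [(hγ.hasDerivWithinAt hs).continuousWithinAt.eventually_mem
    (h.isOpen.mem_nhds hsU), self_mem_nhdsWithin] with r h1 h2
  rw [h.eq_of_isOuterUnitNormal _ h1 (hγ.mem r h2) _ (hν r h2)]

lemma continuousOn_inner_normal (hK : BoundsSmoothStronglyConvexSurface K)
    (hγ : IsUnitSpeedGeodesic (frontier K) ℓ γ)
    (hν : ∀ s ∈ Icc 0 ℓ, IsOuterUnitNormal K (γ s) (ν s)) :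
    ContinuousOn (fun s => ⟪ν s, u⟫) (Icc 0 ℓ) := by
  intro s hs
  obtain ⟨U, f, g, hsU, h⟩ := exists_isLocalNormalField hK (hγ.mem s hs)
  have hev := h.eventually_inner_eq (u := u) hγ hν hs hsU
  refine ContinuousWithinAt.congr_of_eventuallyEq ?_ hev (hev.self_of_nhdsWithin hs)
  have h1 := (h.hasStrictFDerivAt hsU).hasFDerivAt.continuousAt
  have h2 : ContinuousWithinAt (fun r => g (γ r) • gradient f (γ r)) (Icc 0 ℓ) s :=
    h1.comp_continuousWithinAt (hγ.hasDerivWithinAt hs).continuousWithinAt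
  exact h2.inner continuousWithinAt_const

/-- Transverse crossings of the horizon are simple zeros of `⟪ν, u⟫`. -/
lemma exists_hasDerivAt_inner_normal_ne_zero (hK : BoundsSmoothStronglyConvexSurface K)
    (hγ : IsUnitSpeedGeodesic (frontier K) ℓ γ) (hu : u ≠ 0)
    (htrans : CrossesHorizonTransversely K u ℓ γ)
    (hν : ∀ s ∈ Icc 0 ℓ, IsOuterUnitNormal K (γ s) (ν s)) {s : ℝ} (hs : s ∈ Ioo 0 ℓ)
    (hzero : ⟪ν s, u⟫ = 0) : ∃ d ≠ 0, HasDerivAt (fun s => ⟪ν s, u⟫) d s := by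
  have hs' := Ioo_subset_Icc_self hs
  have hsK := hγ.mem s hs'
  obtain ⟨U, f, g, hsU, h⟩ := exists_isLocalNormalField hK hsK
  have hνs := h.eq_of_isOuterUnitNormal _ hsU hsK _ (hν s hs')
  have hev := h.eventually_inner_eq (u := u) hγ hν hs' hsU
  rw [nhdsWithin_eq_nhds.2 (Icc_mem_nhds hs.1 hs.2)] at hev
  refine ⟨⟪fderiv ℝ (fun x => g x • gradient f x) (γ s) (velocity ℓ γ s), u⟫, fun h0 => ?_, ?_⟩
  · refine htrans s hs' ((mem_horizon_iff_inner_eq_zero hK hsK (hν s hs')).2 hzero) ?_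
    refine h.isTangentVector_horizon hK hsU hsK hu (hνs ▸ hzero) ?_ h0
    rw [← hνs, real_inner_comm]
    exact (hν s hs').inner_eq_zero_of_isTangentVector hK.isClosed (hγ.isTangentVector_velocity hs)
  · refine HasDerivAt.congr_of_eventuallyEq ?_ hev
    have := (h.hasStrictFDerivAt hsU).hasFDerivAt.comp_hasDerivAt s (hγ.hasDerivAt hs)
    simpa using this.inner ℝ (hasDerivAt_const s u)

lemma exists_acceleration_eq_smul_normal (hK : BoundsSmoothStronglyConvexSurface K)
    (hγ : IsUnitSpeedGeodesic (frontier K) ℓ γ) {s : ℝ} (hs : s ∈ Ioo 0 ℓ) {n : E3}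
    (hn : IsOuterUnitNormal K (γ s) n) : ∃ a : ℝ, a ≤ 0 ∧ acceleration ℓ γ s = a • n := by
  have hs' := Ioo_subset_Icc_self hs
  have hsK := hγ.mem s hs'
  obtain ⟨U, f, g, hsU, h⟩ := exists_isLocalNormalField hK hsK
  have hns := h.eq_of_isOuterUnitNormal _ hsU hsK _ hn
  have hn0 : n ≠ 0 := by
    rintro rfl
    simpa using hn.1
  have := eq_smul_of_inner_eq_zero hn0 (n := acceleration ℓ γ s) fun v hv => by
    rw [real_inner_comm]
    exact hγ.normal_acceleration s hs' v (h.isTangentVector hsU hsK (hns ▸ hv))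
  refine ⟨_, ?_, this⟩
  rw [hn.1, one_pow, div_one, real_inner_comm]
  exact hγ.inner_acceleration_nonpos hK.isClosed hs hn

/-- The slope angle of the height of a geodesic is monotone along arcs on one side of the
horizon. -/
lemma monotoneOn_arcsin_slope (hK : BoundsSmoothStronglyConvexSurface K) (hℓ : 0 < ℓ)
    (hγ : IsUnitSpeedGeodesic (frontier K) ℓ γ)
    (hν : ∀ s ∈ Icc 0 ℓ, IsOuterUnitNormal K (γ s) (ν s)) {a b ε : ℝ} (ha : 0 ≤ a) (hb : b ≤ ℓ)
    (hε : |ε| = 1) (hsign : ∀ s ∈ Ioo a b, ε * ⟪ν s, u⟫ < 0) :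
    MonotoneOn (fun s => ε * Real.arcsin ⟪u, velocity ℓ γ s⟫) (Icc a b) := by
  have hss : Icc a b ⊆ Icc 0 ℓ := Icc_subset_Icc ha hb
  have hm : MonotoneOn (fun s => ε * ⟪u, velocity ℓ γ s⟫) (Icc a b) := by
    refine monotoneOn_of_hasDerivWithinAt_nonneg
      (f' := fun s => ε * ⟪u, acceleration ℓ γ s⟫) (convex_Icc a b) ?_ ?_ ?_
    · have := (hγ.contDiffOn_velocity hℓ).continuousOn.mono hss
      exact continuousOn_const.mul (continuousOn_const.inner this)
    · intro s hs
      rw [interior_Icc] at hs ⊢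
      have hd := hγ.hasDerivAt_velocity (Ioo_subset_Ioo ha hb hs)
      have := ((hasDerivAt_const s u).inner ℝ hd).const_mul ε
      simpa using this.hasDerivWithinAt
    · intro s hs
      rw [interior_Icc] at hs
      obtain ⟨c, hc, hacc⟩ := exists_acceleration_eq_smul_normal hK hγ (Ioo_subset_Ioo ha hb hs)
        (hν s (hss (Ioo_subset_Icc_self hs)))
      rw [hacc, inner_smul_right, real_inner_comm]
      have := hsign s hs
      nlinarith
  rcases eq_or_eq_neg_of_abs_eq hε with rfl | rfl
  · intro x hx y hy hxy
    have := hm hx hy hxy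
    simp only [one_mul] at this ⊢
    exact Real.monotone_arcsin this
  · intro x hx y hy hxy
    have := hm hx hy hxy
    simp only [neg_mul, one_mul, neg_le_neg_iff] at this ⊢
    exact Real.monotone_arcsin this

end Normal

/-! ### Meeting angles, subdivision and the final estimate -/

lemma meetingAngle_eq {u : E3} {ℓ : ℝ} {γ : ℝ → E3} {s : ℝ} (hu : ‖u‖ = 1)
    (hγ : ‖velocity ℓ γ s‖ = 1) :
    meetingAngle u ℓ γ s = -Real.arcsin ⟪u, velocity ℓ γ s⟫ := by
  rw [meetingAngle, InnerProductGeometry.angle, hu, hγ, Real.arccos, real_inner_comm]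
  simp

/-- The endpoints of `[0, ℓ]` and the meeting moments, as a sequence. -/
noncomputable def subdivision (ℓ : ℝ) {k : ℕ} (t : Fin (k + 1) → ℝ) : ℕ → ℝ
  | 0 => 0
  | i + 1 => if h : i < k + 1 then t ⟨i, h⟩ else ℓ

lemma monotone_subdivision {ℓ : ℝ} {k : ℕ} {t : Fin (k + 1) → ℝ} (ht : StrictMono t)
    (hmem : ∀ i, t i ∈ Icc 0 ℓ) : Monotone (subdivision ℓ t) := by
  refine monotone_nat_of_le_succ fun i => ?_
  rcases i with _ | i
  · simpa [subdivision] using (hmem 0).1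
  · simp only [subdivision]
    split_ifs with h1 h2
    · exact ht.monotone (by simp)
    · exact (hmem _).2
    · omega
    · exact le_rfl

theorem totalCurvature_development_le
    {K : Set E3} (hK : BoundsSmoothStronglyConvexSurface K) {ℓ : ℝ} (hℓ : 0 < ℓ) {γ : ℝ → E3}
    (hγ : IsUnitSpeedGeodesic (frontier K) ℓ γ) {u : E3} (hu : ‖u‖ = 1)
    (htrans : CrossesHorizonTransversely K u ℓ γ)
    {k : ℕ} {t : Fin (k + 1) → ℝ} (ht_mono : StrictMono t)
    (ht_range : range t = {s | s ∈ Icc 0 ℓ ∧ γ s ∈ horizon K u})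
    {e : E2} {δ : ℝ → E2} (hδ : IsDevelopment u ℓ γ e δ) :
    totalCurvature δ 0 ℓ ≤ ENNReal.ofReal (Real.pi +
      2 * |∑ i : Fin (k + 1), (-1 : ℝ) ^ (i : ℕ) * meetingAngle u ℓ γ (t i)|) := by
  have hu0 : u ≠ 0 := by rintro rfl; simp at hu
  have hν : ∀ s, ∃ n, s ∈ Icc 0 ℓ → IsOuterUnitNormal K (γ s) n := fun s => by
    by_cases hs : s ∈ Icc 0 ℓ
    · obtain ⟨n, hn⟩ := hK.exists_isOuterUnitNormal (hγ.mem s hs)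
      exact ⟨n, fun _ => hn⟩
    · exact ⟨0, fun h => absurd h hs⟩
  choose ν hν using hν
  have hmem : ∀ i, t i ∈ Icc 0 ℓ ∧ γ (t i) ∈ horizon K u := fun i => by
    have : t i ∈ range t := mem_range_self i
    rwa [ht_range] at this
  set T := subdivision ℓ t with hTdef
  have hT : Monotone T := monotone_subdivision ht_mono fun i => (hmem i).1
  have hT0 : T 0 = 0 := rfl
  have hTi : ∀ i (h : i < k + 1), T (i + 1) = t ⟨i, h⟩ := fun i h => by
    simp [hTdef, subdivision, Nat.lt_succ_iff.1 h]
  have hTl : T (k + 2) = ℓ := by simp [hTdef, subdivision]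
  have hsub : ∀ i ≤ k + 1, Icc (T i) (T (i + 1)) ⊆ Icc 0 ℓ := fun i hi =>
    Icc_subset_Icc (hT0 ▸ hT (Nat.zero_le i)) (hTl ▸ hT (by omega))
  have hzero : ∀ s ∈ Icc 0 ℓ, (⟪ν s, u⟫ = 0 ↔ s ∈ range t) := fun s hs => by
    rw [ht_range, ← mem_horizon_iff_inner_eq_zero hK (hγ.mem s hs) (hν s hs)]
    exact ⟨fun h => ⟨hs, h⟩, fun h => h.2⟩
  have hTzero : ∀ i, 1 ≤ i → i ≤ k + 1 → ⟪ν (T i), u⟫ = 0 := by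
    intro i h1 h2
    obtain ⟨j, rfl⟩ := Nat.exists_eq_add_of_le' h1
    rw [hTi j h2]
    exact (hzero _ (hmem _).1).2 (mem_range_self _)
  obtain ⟨σ, hσ, hsign⟩ := exists_alternating_signs (G := fun s => ⟪ν s, u⟫) hT (n := k + 1)
    (fun i h1 h2 => by
      obtain ⟨j, rfl⟩ := Nat.exists_eq_add_of_le' h1
      rw [hTi j (by omega), hTi (j + 1) (by omega)]
      exact ht_mono (by simp))
    (fun i hi => (continuousOn_inner_normal hK hγ hν).mono
      (Ioo_subset_Icc_self.trans (hsub i hi)))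
    -- A zero is some `T (j + 1)`, and no term of a monotone sequence lies strictly between two
    -- consecutive ones.
    (fun i hi s hs h0 => by
      obtain ⟨⟨j, hj⟩, rfl⟩ := (hzero s (hsub i hi (Ioo_subset_Icc_self hs))).1 h0
      rw [← hTi j hj] at hs
      have h1 := hT.reflect_lt hs.1
      have h2 := hT.reflect_lt hs.2
      omega)
    hTzero
    (fun i h1 h2 h3 h4 => exists_hasDerivAt_inner_normal_ne_zero hK hγ hu0 htrans hν
      ⟨hT0 ▸ h3, hTl ▸ h4⟩ (hTzero i h1 h2))
  set H : ℝ → ℝ := fun s => ⟪u, velocity ℓ γ s⟫ with hHdef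
  have hmono : ∀ i < k + 2, MonotoneOn (fun s => σ * (-1) ^ i * Real.arcsin (H s))
      (Icc (T i) (T (i + 1))) := fun i hi =>
    monotoneOn_arcsin_slope hK hℓ hγ hν (hT0 ▸ hT (Nat.zero_le i)) (hTl ▸ hT (by omega))
      (by rw [abs_mul, hσ]; simp) (hsign i (by omega))
  have hH1 : ∀ s ∈ Icc 0 ℓ, |H s| ≤ 1 := fun s hs => by
    simpa [hu, hγ.unit_speed s hs] using abs_real_inner_le_norm u (velocity ℓ γ s)
  have hHc : ContinuousOn H (Icc 0 ℓ) :=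
    continuousOn_const.inner (hγ.contDiffOn_velocity hℓ).continuousOn
  have hH : ∀ s ∈ Icc 0 ℓ, HasDerivWithinAt (fun s => ⟪e, δ s⟫) (H s) (Icc 0 ℓ) s := fun s hs => by
    have : HasDerivWithinAt (fun s => ⟪u, γ s⟫) (H s) (Icc 0 ℓ) s := by
      simpa using (hasDerivWithinAt_const s (Icc 0 ℓ) u).inner ℝ (hγ.hasDerivWithinAt hs)
    exact this.congr (fun r hr => hδ.height r hr) (hδ.height s hs)
  obtain ⟨w, hfr, hw⟩ : ∃ w, IsPlaneFrame e w ∧ MonotoneOn (fun s => ⟪w, δ s⟫) (Icc 0 ℓ) := by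
    obtain ⟨w, hfr⟩ := exists_isPlaneFrame hδ.norm_eq_one
    rcases hδ.monotone_projection w hfr.inner_eq_zero with h | h
    · exact ⟨w, hfr, h⟩
    · refine ⟨-w, hfr.neg_right, ?_⟩
      simp only [inner_neg_left]
      exact h.neg
  refine (totalCurvature_le_eVariationOn hfr hδ.arc_length hw hH hHc hH1).trans ?_
  have hvar := eVariationOn_le_alternating_sum hT hσ hmono
  rw [hT0, hTl] at hvar
  refine hvar.trans (ENNReal.ofReal_le_ofReal ?_)
  rw [alternating_sum_sub_eq (fun i => Real.arcsin (H (T i)))]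
  have hsum : ∑ i : Fin (k + 1), (-1 : ℝ) ^ (i : ℕ) * meetingAngle u ℓ γ (t i) =
      -∑ i ∈ Finset.range (k + 1), (-1) ^ i * Real.arcsin (H (T (i + 1))) := by
    rw [Finset.sum_range, ← Finset.sum_neg_distrib]
    refine Finset.sum_congr rfl fun i _ => ?_
    rw [meetingAngle_eq hu (hγ.unit_speed _ (hmem i).1), hTi i i.2]
    simp only [hHdef]
    ring
  rw [hsum, abs_neg]
  have harc : ∀ ε x : ℝ, |ε| = 1 → ε * Real.arcsin x ≤ Real.pi / 2 := fun ε x hε => by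
    refine (le_abs_self _).trans ?_
    rw [abs_mul, hε, one_mul, abs_le]
    exact ⟨Real.neg_pi_div_two_le_arcsin x, Real.arcsin_le_pi_div_two x⟩
  -- The two unpaired end terms; together they cost `π`.
  have h1 := harc (-σ) (H (T 0)) (by rw [abs_neg, hσ])
  have h2 := harc (σ * (-1) ^ (k + 1)) (H (T (k + 2))) (by rw [abs_mul, hσ]; simp)
  have h3 := le_abs_self (σ * ∑ i ∈ Finset.range (k + 1), (-1) ^ i * Real.arcsin (H (T (i + 1))))
  rw [abs_mul, hσ, one_mul] at h3
  linarith

end ConvexSurface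

theorem mainTheorem6
    (K : Set ConvexSurface.E3) (hK : ConvexSurface.BoundsSmoothStronglyConvexSurface K)
    (ℓ : ℝ) (hℓ : 0 < ℓ) (γ : ℝ → ConvexSurface.E3)
    (hγ : ConvexSurface.IsUnitSpeedGeodesic (frontier K) ℓ γ)
    (u : ConvexSurface.E3) (hu : ‖u‖ = 1)
    (htrans : ConvexSurface.CrossesHorizonTransversely K u ℓ γ)
    (k : ℕ) (t : Fin (k + 1) → ℝ) (ht_mono : StrictMono t)
    (ht_range : Set.range t = {s | s ∈ Set.Icc 0 ℓ ∧ γ s ∈ ConvexSurface.horizon K u})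
    (e : ConvexSurface.E2) (δ : ℝ → ConvexSurface.E2)
    (hδ : ConvexSurface.IsDevelopment u ℓ γ e δ) :
    ConvexSurface.totalCurvature δ 0 ℓ ≤
      ENNReal.ofReal (3 * Real.pi +
        2 * |∑ i : Fin (k + 1), (-1 : ℝ) ^ (i : ℕ) * ConvexSurface.meetingAngle u ℓ γ (t i)|) := by
  refine (ConvexSurface.totalCurvature_development_le hK hℓ hγ hu htrans ht_mono ht_range
    hδ).trans (ENNReal.ofReal_le_ofReal ?_)
  linarith [Real.pi_pos]
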